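/- **Conventions.** Let $M$ be a smooth manifold of dimension $2n+1$ with an almost contact metric structure $(\phi,\xi,\eta,g)$: smooth tensor fields with $\eta(\xi)=1$, $\phi^2=-I+\eta\otimes\xi$, $\eta\circ\phi=0$, $\phi\xi=0$, $g(\phi X,\phi Y)=g(X,Y)-\eta(X)\eta(Y)$ and $g(X,\xi)=\eta(X)$, where $g$ is a Riemannian metric. Put $\omega(X,Y)=g(\phi X,Y)$ and $h=\tfrac12\mathcal L_\xi\phi$, let $\nabla$ be the Levi-Civita connection of $g$, and let $R(X,Y)Z=\nabla_X\nabla_YZ-\nabla_Y\nabla_XZ-\nabla_{[X,Y]}Z$. The structure is *almost cosymplectic* if $d\eta=0$ and $d\omega=0$; it is *cosymplectic* if moreover it is normal, i.e. $[\phi,\phi](X,Y)+\big(X\eta(Y)-Y\eta(X)-\eta([X,Y])\big)\xi=0$ for all vector fields $X,Y$. It is an *almost cosymplectic $(\kappa,\mu)$-structure*, $\kappa,\mu\in\mathbb R$, if it is almost cosymplectic and $$R(X,Y)\xi=\kappa\big(\eta(Y)X-\eta(X)Y\big)+\mu\big(\eta(Y)hX-\eta(X)hY\big)\quad\text{for all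 vector fields }X,Y.$$ An *Einstein–Weyl structure with Lee form $\theta$* (with respect to $g$), $\theta$ a smooth 1-form, is a torsion-free linear connection $D$ with $Dg=-2\theta\otimes g$ such that $\mathrm{Ric}^D(Y,X)+\mathrm{Ric}^D(X,Y)=\Lambda\, g(Y,X)$ for some $\Lambda\in C^\infty(M)$, where $\mathrm{Ric}^D(Y,Z)=\operatorname{tr}(X\mapsto R^D(X,Y)Z)$. The metric $g$ is *Einstein* if $\mathrm{Ric}=c\,g$ for a constant $c$. **Theorem.** Let $M$ be a $(2n+1)$-dimensional almost cosymplectic $(\kappa,\mu)$-manifold, with $\kappa\neq 0$ in case $n\ge 2$. If $M$ admits two Einstein–Weyl structures with Lee forms $\theta$ and $-\theta$ with respect to $g$, then $M$ is either cosymplectic or Einstein (as a non-exclusive alternative). -/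

import Mathlib

open scoped Manifold ContDiff Bundle

noncomputable section

namespace AlmostCosymplectic

/-- Vector fields (not necessarily smooth) on an `m`-dimensional manifold. -/
abbrev VField (m : ℕ) (M : Type*) [TopologicalSpace M]
    [ChartedSpace (EuclideanSpace ℝ (Fin m)) M] :=
  (x : M) → TangentSpace (𝓡 m) x

/-- 1-forms (not necessarily smooth). -/
abbrev OneForm (m : ℕ) (M : Type*) [TopologicalSpace M]
    [ChartedSpace (EuclideanSpace ℝ (Fin m)) M] :=
  (x : M) → TangentSpace (𝓡 m) x →L[ℝ] ℝ

/-- Fields of endomorphisms of the tangent spaces, i.e. (1,1)-tensor fields. -/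
abbrev EndoField (m : ℕ) (M : Type*) [TopologicalSpace M]
    [ChartedSpace (EuclideanSpace ℝ (Fin m)) M] :=
  (x : M) → TangentSpace (𝓡 m) x →L[ℝ] TangentSpace (𝓡 m) x

/-- Smooth Riemannian metrics. -/
abbrev Metric (m : ℕ) (M : Type*) [TopologicalSpace M]
    [ChartedSpace (EuclideanSpace ℝ (Fin m)) M] [IsManifold (𝓡 m) ∞ M] :=
  Bundle.ContMDiffRiemannianMetric (𝓡 m) ∞ (EuclideanSpace ℝ (Fin m))
    (fun x : M => TangentSpace (𝓡 m) x)

/-- Linear connections on the tangent bundle. `D Y x (X x)` is `(D_X Y)(x)`. -/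
abbrev Connection (m : ℕ) (M : Type*) [TopologicalSpace M]
    [ChartedSpace (EuclideanSpace ℝ (Fin m)) M] [IsManifold (𝓡 m) ∞ M] :=
  CovariantDerivative (𝓡 m) (EuclideanSpace ℝ (Fin m))
    (fun x : M => TangentSpace (𝓡 m) x)

variable {m : ℕ} {M : Type*} [TopologicalSpace M]
  [ChartedSpace (EuclideanSpace ℝ (Fin m)) M] [IsManifold (𝓡 m) ∞ M]

/-- Smoothness of a vector field, as a section of the tangent bundle. -/
def SmoothVField (X : VField m M) : Prop :=
  ContMDiff (𝓡 m) ((𝓡 m).prod 𝓘(ℝ, EuclideanSpace ℝ (Fin m))) ∞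
    (fun x => Bundle.TotalSpace.mk' (EuclideanSpace ℝ (Fin m)) x (X x))

/-- Smoothness of a 1-form, as a section of the cotangent bundle. -/
def SmoothOneForm (θ : OneForm m M) : Prop :=
  ContMDiff (𝓡 m) ((𝓡 m).prod 𝓘(ℝ, EuclideanSpace ℝ (Fin m) →L[ℝ] ℝ)) ∞
    (fun x => Bundle.TotalSpace.mk' (EuclideanSpace ℝ (Fin m) →L[ℝ] ℝ)
      (E := fun x : M => TangentSpace (𝓡 m) x →L[ℝ] ℝ) x (θ x))

/-- Smoothness of a (1,1)-tensor field, as a section of the endomorphism bundle. -/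
def SmoothEndoField (φ : EndoField m M) : Prop :=
  ContMDiff (𝓡 m)
    ((𝓡 m).prod 𝓘(ℝ, EuclideanSpace ℝ (Fin m) →L[ℝ] EuclideanSpace ℝ (Fin m))) ∞
    (fun x => Bundle.TotalSpace.mk'
      (EuclideanSpace ℝ (Fin m) →L[ℝ] EuclideanSpace ℝ (Fin m))
      (E := fun x : M => TangentSpace (𝓡 m) x →L[ℝ] TangentSpace (𝓡 m) x) x (φ x))

/-- The derivative `X f` of a function along a vector field. -/
def dirDeriv (X : VField m M) (f : M → ℝ) (x : M) : ℝ :=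
  mvfderiv (𝓡 m) f x (X x)

/-- The Lie bracket `[X, Y]`. -/
def bracket (X Y : VField m M) : VField m M :=
  VectorField.mlieBracket (𝓡 m) X Y

/-- The vector field `φ X`. -/
def EndoField.app (φ : EndoField m M) (X : VField m M) : VField m M :=
  fun x => φ x (X x)

/-- `(dη)(X, Y) = X (η Y) - Y (η X) - η [X, Y]`. -/
def extDerivOne (η : OneForm m M) (X Y : VField m M) (x : M) : ℝ :=
  dirDeriv X (fun y => η y (Y y)) x - dirDeriv Y (fun y => η y (X y)) x
    - η x (bracket X Y x)

/-- For a field `β` of bilinear forms (alternating in the application),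
`(dβ)(X, Y, Z) = X β(Y, Z) + Y β(Z, X) + Z β(X, Y) - β([X, Y], Z) - β([Y, Z], X) - β([Z, X], Y)`. -/
def extDerivTwo (β : (x : M) → TangentSpace (𝓡 m) x → TangentSpace (𝓡 m) x → ℝ)
    (X Y Z : VField m M) (x : M) : ℝ :=
  dirDeriv X (fun y => β y (Y y) (Z y)) x + dirDeriv Y (fun y => β y (Z y) (X y)) x
    + dirDeriv Z (fun y => β y (X y) (Y y)) x
    - β x (bracket X Y x) (Z x) - β x (bracket Y Z x) (X x) - β x (bracket Z X x) (Y x)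

/-! ### Connections and curvature -/

/-- The vector field `D_X Y`. -/
def covDeriv (D : Connection m M) (X Y : VField m M) : VField m M :=
  fun x => D Y x (X x)

/-- Smooth torsion-free connections: `D_X Y - D_Y X = [X, Y]`. -/
structure IsTorsionFree (D : Connection m M) : Prop where
  smooth : CovariantDerivative.ContMDiffCovariantDerivative D ∞
  torsion_free : ∀ X Y : VField m M, SmoothVField X → SmoothVField Y → ∀ x : M,
    covDeriv D X Y x - covDeriv D Y X x = bracket X Y x

/-- `(D_Z g)(X, Y) = Z g(X, Y) - g(D_Z X, Y) - g(X, D_Z Y)`. -/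
def covDerivMetric (D : Connection m M) (g : Metric m M) (Z X Y : VField m M) (x : M) : ℝ :=
  dirDeriv Z (fun y => g.inner y (X y) (Y y)) x
    - g.inner x (covDeriv D Z X x) (Y x) - g.inner x (X x) (covDeriv D Z Y x)

/-- `D` is the Levi-Civita connection of `g`: torsion-free with `D g = 0`. -/
structure IsLeviCivita (g : Metric m M) (D : Connection m M) : Prop
    extends IsTorsionFree D where
  metric : ∀ X Y Z : VField m M, SmoothVField X → SmoothVField Y → SmoothVField Z →
    ∀ x : M, covDerivMetric D g Z X Y x = 0

/-- `R(X, Y) Z = D_X D_Y Z - D_Y D_X Z - D_[X, Y] Z`. -/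
def curvature (D : Connection m M) (X Y Z : VField m M) : VField m M :=
  fun x => covDeriv D X (covDeriv D Y Z) x - covDeriv D Y (covDeriv D X Z) x
    - covDeriv D (bracket X Y) Z x

/-- The Ricci tensor `Ric(Y, Z)(x)`, the trace of the endomorphism `v ↦ R(v, Y) Z` of `T_x M`.
The trace is computed in a basis `e` of `T_x M`, as the sum of the `e_i`-components of
`R(e_i, Y) Z`; each `e_i` is extended to a vector field that is smooth near `x`
(`R` is tensorial, so neither the basis nor the extension matters). -/
def ricci (D : Connection m M) (Y Z : VField m M) (x : M) : ℝ :=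
  let e : Module.Basis (Fin m) ℝ (TangentSpace (𝓡 m) x) :=
    (EuclideanSpace.basisFun (Fin m) ℝ).toBasis
  ∑ i, e.coord i
    (curvature D (FiberBundle.extend (EuclideanSpace ℝ (Fin m)) (e i)) Y Z x)

/-- The metric `g`, with Levi-Civita connection `D`, is Einstein: `Ric = c g` for a constant `c`. -/
def IsEinstein (g : Metric m M) (D : Connection m M) : Prop :=
  ∃ c : ℝ, ∀ Y Z : VField m M, SmoothVField Y → SmoothVField Z → ∀ x : M,
    ricci D Y Z x = c * g.inner x (Y x) (Z x)

/-- `(D, [g])` is a Weyl structure with Lee form `θ` with respect to `g`: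
`D` is torsion-free and `D g = -2 θ ⊗ g`. -/
structure IsWeyl (g : Metric m M) (θ : OneForm m M) (D : Connection m M) : Prop
    extends IsTorsionFree D where
  smooth_lee : SmoothOneForm θ
  weyl : ∀ X Y Z : VField m M, SmoothVField X → SmoothVField Y → SmoothVField Z →
    ∀ x : M, covDerivMetric D g Z X Y x = -2 * θ x (Z x) * g.inner x (X x) (Y x)

/-- Einstein-Weyl structures: the symmetrized Ricci tensor of `D` is a multiple
of `g` by a smooth function. -/
structure IsEinsteinWeyl (g : Metric m M) (θ : OneForm m M) (D : Connection m M) : Prop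
    extends IsWeyl g θ D where
  einstein_weyl : ∃ Λ : M → ℝ, ContMDiff (𝓡 m) 𝓘(ℝ, ℝ) ∞ Λ ∧
    ∀ X Y : VField m M, SmoothVField X → SmoothVField Y → ∀ x : M,
      ricci D Y X x + ricci D X Y x = Λ x * g.inner x (Y x) (X x)

/-! ### Almost contact metric structures -/

variable (m M) in
/-- Almost contact metric structures `(φ, ξ, η, g)`. -/
structure AlmostContactMetric where
  φ : EndoField m M
  ξ : VField m M
  η : OneForm m M
  g : Metric m M
  smooth_φ : SmoothEndoField φ
  smooth_ξ : SmoothVField ξ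
  smooth_η : SmoothOneForm η
  η_ξ : ∀ x, η x (ξ x) = 1
  φ_sq : ∀ x v, φ x (φ x v) = -v + η x v • ξ x
  η_φ : ∀ x v, η x (φ x v) = 0
  φ_ξ : ∀ x, φ x (ξ x) = 0
  compatible : ∀ x v w, g.inner x (φ x v) (φ x w) = g.inner x v w - η x v * η x w
  g_ξ : ∀ x v, g.inner x v (ξ x) = η x v

namespace AlmostContactMetric

/-- The fundamental 2-form `ω(X, Y) = g(φ X, Y)`. -/
def fundForm (S : AlmostContactMetric m M) (x : M) (v w : TangentSpace (𝓡 m) x) : ℝ :=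
  S.g.inner x (S.φ x v) w

/-- `h = ½ L_ξ φ`, that is `h X = ½ ([ξ, φ X] - φ [ξ, X])`. -/
def h (S : AlmostContactMetric m M) (X : VField m M) : VField m M :=
  fun x => (1 / 2 : ℝ) •
    (bracket S.ξ (EndoField.app S.φ X) x - S.φ x (bracket S.ξ X x))

/-- The structure is almost cosymplectic: `dη = 0` and `dω = 0`. -/
structure IsAlmostCosymplectic (S : AlmostContactMetric m M) : Prop where
  closed_η : ∀ X Y : VField m M, SmoothVField X → SmoothVField Y → ∀ x : M,
    extDerivOne S.η X Y x = 0
  closed_fundForm : ∀ X Y Z : VField m M, SmoothVField X → SmoothVField Y → SmoothVField Z →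
    ∀ x : M, extDerivTwo S.fundForm X Y Z x = 0

/-- The Nijenhuis torsion
`[φ, φ](X, Y) = φ² [X, Y] + [φ X, φ Y] - φ [φ X, Y] - φ [X, φ Y]`. -/
def nijenhuis (S : AlmostContactMetric m M) (X Y : VField m M) : VField m M :=
  fun x => S.φ x (S.φ x (bracket X Y x))
    + bracket (EndoField.app S.φ X) (EndoField.app S.φ Y) x
    - S.φ x (bracket (EndoField.app S.φ X) Y x) - S.φ x (bracket X (EndoField.app S.φ Y) x)

/-- Normality, `[φ, φ] + dη ⊗ ξ = 0`, i.e. integrability of the almost complex structure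
`J (X, a ∂_t) = (φ X - a ξ, η(X) ∂_t)` on `M × ℝ`. Since `dη` carries no factor `½` here, this is
the condition often written `[φ, φ] + 2 dη ⊗ ξ = 0`. -/
def IsNormal (S : AlmostContactMetric m M) : Prop :=
  ∀ X Y : VField m M, SmoothVField X → SmoothVField Y → ∀ x : M,
    S.nijenhuis X Y x + extDerivOne S.η X Y x • S.ξ x = 0

/-- Cosymplectic (also called coKähler): almost cosymplectic and normal. -/
structure IsCosymplectic (S : AlmostContactMetric m M) : Prop
    extends IsAlmostCosymplectic S where
  normal : S.IsNormal

/-- Almost cosymplectic `(κ, μ)`-structures, where `D` is the Levi-Civita connection of `g`: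
`R(X, Y) ξ = κ (η(Y) X - η(X) Y) + μ (η(Y) h X - η(X) h Y)`. -/
structure IsKappaMu (S : AlmostContactMetric m M) (D : Connection m M) (κ μ : ℝ) : Prop
    extends IsAlmostCosymplectic S where
  curvature_ξ : ∀ X Y : VField m M, SmoothVField X → SmoothVField Y → ∀ x : M,
    curvature D X Y S.ξ x =
      κ • (S.η x (Y x) • X x - S.η x (X x) • Y x)
        + μ • (S.η x (Y x) • S.h X x - S.η x (X x) • S.h Y x)

end AlmostContactMetric

end AlmostCosymplectic

end

/-! Write A = ∇ξ. Since η and ω are closed, A is symmetric, kills ξ and anticommutes with φ, and h =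
φA. The nullity condition then gives A² = −κ on the leaves of η = 0 (`A_sq`), so that κ ≤ 0 as soon
as there is a horizontal vector.

If n = 0, the tangent spaces are spanned by ξ and φ = 0. If n = 1 and κ = 0, then A = 0, and the
skewness of ∇φ leaves it no room in dimension three, so φ is parallel. Both cases are cosymplectic,
because the Nijenhuis torsion vanishes when φ is parallel.

The remaining case, n ≥ 1 and κ < 0 at some point, is impossible (`not_einsteinWeyl_pair`). The
Einstein alternative is therefore reached only on an empty manifold. Put m = 2n + 1 and let V be the
field dual to θ. The part of the Weyl curvature linear in V is odd and the quadratic part is even.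
So adding the two Einstein–Weyl equations shows that the symmetrized Ric + (m − 2) θ⊗θ is pointwise
proportional to g (`exists_ricci_eq`), and subtracting them shows that V is conformal Killing
(`exists_conformal_killing`).

As Ric(Y, ξ) = 0 for horizontal Y, the first relation gives θ(Y)θ(ξ) = 0. Where θ(ξ) = 0, it makes
the factor of g negative, because Ric(ξ, ξ) = (m − 1)κ < 0; but Ric(Y, Y) + Ric(φY, φY) = 0 makes it
nonnegative. Where θ(ξ) ≠ 0, V is locally θ(ξ)ξ, and the conformal Killing equation makes A a
multiple of the identity on the leaf. Anticommutation with φ forces the multiple to be 0,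
contradicting A² = −κ ≠ 0.

The identity Ric(Y, Y) + Ric(φY, φY) = 0 comes from the flatness of the leaves for κ < 0
(`K_eq_zero`). Along the leaves A and φ are parallel up to ξ-components, so the Gauss curvature is
compatible with both, and the eigenspaces of A together with the Bianchi identity kill it. -/

noncomputable section

/-! ### Formal tensor calculus: curvature symmetries, ∇ξ and ∇φ. -/

namespace AlmostCosymplectic

/-- The algebra underlying an almost cosymplectic manifold: `C` plays the role of the ring of
smooth functions, `L` that of the module of smooth vector fields, `D` that of the Levi-Civita
connection. -/
structure CosymplecticAlgebra (C L : Type*) [CommRing C] [Algebra ℝ C] [AddCommGroup L]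
    [Module C L] where
  act : L →ₗ[C] Derivation ℝ C C
  D : L →ₗ[C] L →+ L
  g : L →ₗ[C] L →ₗ[C] C
  φ : L →ₗ[C] L
  ξ : L
  leibniz : ∀ X f Y, D X (f • Y) = f • D X Y + act X f • Y
  jacobi : ∀ X Y Z,
    (D X (D Y Z - D Z Y) - D (D Y Z - D Z Y) X)
      = (D (D X Y - D Y X) Z - D Z (D X Y - D Y X)) + (D Y (D X Z - D Z X) - D (D X Z - D Z X) Y)
  symm : ∀ X Y, g X Y = g Y X
  definite : ∀ X, g X X = 0 → X = 0
  metric : ∀ X Y Z, act X (g Y Z) = g (D X Y) Z + g Y (D X Z)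
  unit : g ξ ξ = 1
  φ_sq : ∀ X, φ (φ X) = - X + g X ξ • ξ
  η_φ : ∀ X, g (φ X) ξ = 0
  φ_ξ : φ ξ = 0
  compatible : ∀ X Y, g (φ X) (φ Y) = g X Y - g X ξ * g Y ξ
  closed_η : ∀ X Y, act X (g Y ξ) - act Y (g X ξ) - g (D X Y - D Y X) ξ = 0
  closed_ω : ∀ X Y Z, act X (g (φ Y) Z) + act Y (g (φ Z) X) + act Z (g (φ X) Y)
    - g (φ (D X Y - D Y X)) Z - g (φ (D Y Z - D Z Y)) X - g (φ (D Z X - D X Z)) Y = 0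

namespace CosymplecticAlgebra

variable {C L : Type*} [CommRing C] [Algebra ℝ C] [AddCommGroup L] [Module C L]

/-- A ring of functions has zero divisors, but the scalar 2 is invertible because the ring is a real
algebra. -/
lemma eq_zero_of_two_mul {a : C} (h : 2 * a = 0) : a = 0 := by
  have h2 : algebraMap ℝ C (1 / 2) * 2 = 1 := by
    rw [← map_ofNat (algebraMap ℝ C) 2, ← map_mul]; norm_num
  linear_combination algebraMap ℝ C (1 / 2) * h - a * h2

variable (G : CosymplecticAlgebra C L)

/-- The Lie bracket. -/
def br (X Y : L) : L := G.D X Y - G.D Y X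

/-- The curvature operator. -/
def R (X Y Z : L) : L := G.D X (G.D Y Z) - G.D Y (G.D X Z) - G.D (G.br X Y) Z

lemma eq_of_g {X Y : L} (h : ∀ Z, G.g X Z = G.g Y Z) : X = Y := by
  have : G.g (X - Y) (X - Y) = 0 := by
    simp only [map_sub, LinearMap.sub_apply, h, sub_self]
  exact sub_eq_zero.1 (G.definite _ this)

/-- This follows from the Jacobi identity: its defect of function-linearity in the last argument,
evaluated at `f • ξ` and paired with the unit field ξ, is exactly the claim. -/
lemma act_br (X Y : L) (f : C) :
    G.act (G.br X Y) f = G.act X (G.act Y f) - G.act Y (G.act X f) := by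
  have h := G.jacobi X Y (f • G.ξ)
  have h0 := G.jacobi X Y G.ξ
  simp only [G.leibniz, map_add, map_sub, map_smul, AddMonoidHom.smul_apply,
    AddMonoidHom.sub_apply, AddMonoidHom.add_apply] at h h0
  have hg := congrArg (fun v => G.g v G.ξ) h
  have hg0 := congrArg (fun v => G.g v G.ξ) h0
  simp only [map_add, map_sub, map_smul, LinearMap.smul_apply, smul_eq_mul, LinearMap.sub_apply,
    LinearMap.add_apply, G.unit] at hg hg0
  simp only [br, map_sub, Derivation.sub_apply]
  linear_combination f * hg0 - hg

/-! ### Symmetries of the curvature -/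

lemma R_swap (X Y Z : L) : G.R Y X Z = - G.R X Y Z := by
  simp only [R, br, map_sub, AddMonoidHom.sub_apply]; abel

lemma R_bianchi (X Y Z : L) : G.R X Y Z + G.R Y Z X + G.R Z X Y = 0 := by
  have h := G.jacobi X Y Z
  simp only [map_sub, AddMonoidHom.sub_apply] at h
  simp only [R, br, map_sub, AddMonoidHom.sub_apply]
  rw [← sub_eq_zero] at h
  rw [← h]; abel

lemma R_skew (X Y Z W : L) : G.g (G.R X Y Z) W = - G.g Z (G.R X Y W) := by
  have h3 := G.act_br X Y (G.g Z W)
  simp only [map_add, G.metric] at h3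
  simp only [R, map_sub, LinearMap.sub_apply]
  linear_combination - h3

lemma R_skew' (X Y Z W : L) : G.g (G.R X Y Z) W = - G.g (G.R X Y W) Z := by
  rw [R_skew, G.symm]

/-- The usual octahedron argument: four Bianchi identities combined with both skew symmetries. -/
lemma R_pair (X Y Z W : L) : G.g (G.R X Y Z) W = G.g (G.R Z W X) Y := by
  have b (A B E F : L) : G.g (G.R A B E) F + G.g (G.R B E A) F + G.g (G.R E A B) F = 0 := by
    rw [← LinearMap.add_apply, ← map_add, ← LinearMap.add_apply, ← map_add, R_bianchi]; simp
  have s (A B E F : L) : G.g (G.R A B E) F = - G.g (G.R B A E) F := by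
    rw [R_swap]; simp
  have k := G.R_skew'
  refine sub_eq_zero.1 (eq_zero_of_two_mul ?_)
  linear_combination b X Y Z W + b Y Z W X - b Z W X Y - b W X Y Z - k Y Z X W
    - (s Z X Y W - k X Z Y W) - k Z W Y X - (s W Y Z X - k Y W Z X) + k W X Z Y + k X Y W Z

/-! ### The tensor `A = ∇ξ` -/

/-- The tensor `A = ∇ξ`. -/
def A : L →ₗ[C] L where
  toFun X := G.D X G.ξ
  map_add' X Y := by simp
  map_smul' f X := by simp

lemma A_apply (X : L) : G.A X = G.D X G.ξ := rfl

lemma act_one (X : L) : G.act X 1 = 0 := Derivation.map_one_eq_zero _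

lemma η_A (X : L) : G.g (G.A X) G.ξ = 0 := by
  have h := G.metric X G.ξ G.ξ
  rw [G.unit, act_one, G.symm G.ξ] at h
  exact eq_zero_of_two_mul (by rw [A_apply]; linear_combination -h)

lemma A_symm (X Y : L) : G.g (G.A X) Y = G.g X (G.A Y) := by
  have h := G.closed_η X Y
  simp only [G.metric, map_sub, LinearMap.sub_apply] at h
  rw [G.symm, A_apply, A_apply]
  linear_combination h

lemma A_ξ : G.A G.ξ = 0 := by
  refine G.eq_of_g fun Z => ?_
  rw [A_symm, G.symm, η_A]; simp

lemma φ_skew (X Y : L) : G.g (G.φ X) Y = - G.g X (G.φ Y) := by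
  have h := G.compatible X (G.φ Y)
  rw [G.φ_sq, G.η_φ] at h
  simp only [map_add, map_neg, map_smul, smul_eq_mul, G.η_φ] at h
  linear_combination -h

/-- `dφ X Y = (∇_X φ) Y`. -/
def dφ (X Y : L) : L := G.D X (G.φ Y) - G.φ (G.D X Y)

/-- `dA X Y = (∇_X A) Y`. -/
def dA (X Y : L) : L := G.D X (G.A Y) - G.A (G.D X Y)

lemma dφ_skew (X Y Z : L) : G.g (G.dφ X Y) Z = - G.g Y (G.dφ X Z) := by
  have h := G.metric X (G.φ Y) Z
  have h' := G.metric X Y (G.φ Z)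
  rw [φ_skew, map_neg] at h
  simp only [dφ, map_sub, LinearMap.sub_apply]
  linear_combination -h - h' - G.φ_skew Y (G.D X Z) - G.φ_skew (G.D X Y) Z

lemma dA_symm (X Y Z : L) : G.g (G.dA X Y) Z = G.g Y (G.dA X Z) := by
  have h := G.metric X (G.A Y) Z
  have h' := G.metric X Y (G.A Z)
  rw [A_symm] at h
  simp only [dA, map_sub, LinearMap.sub_apply]
  linear_combination h' - h - G.A_symm Y (G.D X Z) - G.A_symm (G.D X Y) Z

lemma dφ_cyclic (X Y Z : L) :
    G.g (G.dφ X Y) Z + G.g (G.dφ Y Z) X + G.g (G.dφ Z X) Y = 0 := by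
  have h := G.closed_ω X Y Z
  simp only [G.metric, map_sub, LinearMap.sub_apply] at h
  simp only [dφ, map_sub, LinearMap.sub_apply]
  linear_combination h - G.φ_skew (G.D Z Y) X + G.symm (G.D Z Y) (G.φ X)
    - G.φ_skew (G.D X Z) Y + G.symm (G.D X Z) (G.φ Y) - G.φ_skew (G.D Y X) Z
    + G.symm (G.D Y X) (G.φ Z)

lemma D_φ (X Y : L) : G.D X (G.φ Y) = G.dφ X Y + G.φ (G.D X Y) := by simp [dφ]

lemma D_A (X Y : L) : G.D X (G.A Y) = G.dA X Y + G.A (G.D X Y) := by simp [dA]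

lemma act_η (X Y : L) : G.act X (G.g Y G.ξ) = G.g (G.D X Y) G.ξ + G.g Y (G.A X) := G.metric ..

lemma D_neg (X Y : L) : G.D X (-Y) = - G.D X Y := map_neg _ _

lemma dφ_φ (X Y : L) :
    G.dφ X (G.φ Y) + G.φ (G.dφ X Y) = G.g Y (G.A X) • G.ξ + G.g Y G.ξ • G.A X := by
  simp only [dφ, G.φ_sq, map_add, map_sub, D_neg, G.leibniz, act_η, ← A_apply]
  module

lemma dφ_ξ_right (X : L) : G.dφ X G.ξ = - G.φ (G.A X) := by
  simp [dφ, G.φ_ξ, A_apply]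

/-- In an almost cosymplectic structure `∇_ξ φ = 0` and `A φ = - φ A`. -/
lemma dφ_ξ_and_anticomm (X : L) : G.dφ G.ξ X = 0 ∧ G.A (G.φ X) + G.φ (G.A X) = 0 := by
  -- This is dω = 0 with ξ in one slot, using (∇_X φ)ξ = −φAX.
  have h1 (X : L) : G.dφ G.ξ X + (G.A (G.φ X) + G.φ (G.A X)) = 0 := by
    refine G.eq_of_g fun Z => ?_
    have h := G.dφ_cyclic G.ξ X Z
    rw [G.dφ_skew X Z, dφ_ξ_right, dφ_ξ_right] at h
    simp only [map_add, LinearMap.add_apply, map_neg, LinearMap.neg_apply, map_zero,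
      LinearMap.zero_apply] at h ⊢
    linear_combination h + G.A_symm (G.φ X) Z + G.φ_skew (G.A Z) X - G.symm (G.A Z) (G.φ X)
      + G.symm (G.φ (G.A X)) Z
  have h2 := G.dφ_φ G.ξ X
  rw [A_ξ, map_zero, zero_smul, smul_zero, add_zero] at h2
  have e1 := h1 X
  have e2 := h1 (G.φ X)
  -- Differentiating φ² along ξ shows that ∇_ξ φ anticommutes with φ, whereas Aφ + φA commutes with
  -- it. Since their sum is zero, twice φ(Aφ + φA) vanishes.
  have key : G.φ (G.A (G.φ X) + G.φ (G.A X)) = 0 := by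
    rw [eq_neg_of_add_eq_zero_left e1, map_neg] at h2
    rw [eq_neg_of_add_eq_zero_left e2] at h2
    simp only [G.φ_sq, map_add, map_neg, map_smul, A_ξ, η_A, smul_zero, add_zero, zero_smul] at h2 ⊢
    refine G.eq_of_g fun Z => eq_zero_of_two_mul ?_ |>.trans (by simp)
    have := congrArg (fun v => G.g v Z) h2
    simp only [map_add, map_neg, map_zero, LinearMap.add_apply, LinearMap.neg_apply,
      LinearMap.zero_apply] at this ⊢
    linear_combination - this
  have hC : G.A (G.φ X) + G.φ (G.A X) = 0 := by
    have := congrArg G.φ key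
    rw [G.φ_sq, map_zero] at this
    simpa only [map_add, LinearMap.add_apply, η_A, G.η_φ, zero_smul, add_zero, neg_eq_zero]
      using this
  rw [hC, add_zero] at e1
  exact ⟨e1, hC⟩

lemma dφ_ξ (X : L) : G.dφ G.ξ X = 0 := (G.dφ_ξ_and_anticomm X).1

lemma A_φ (X : L) : G.A (G.φ X) = - G.φ (G.A X) :=
  eq_neg_of_add_eq_zero_left (G.dφ_ξ_and_anticomm X).2

/-- Twice the tensor `h = ½ L_ξ φ`. -/
lemma two_h (X : L) : G.br G.ξ (G.φ X) - G.φ (G.br G.ξ X) = (2 : C) • G.φ (G.A X) := by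
  have h := G.dφ_ξ X
  have h2 := G.A_φ X
  simp only [br, map_sub, dφ, A_apply] at h h2 ⊢
  rw [h2, ← sub_eq_zero, ← h]
  module

end CosymplecticAlgebra

end AlmostCosymplectic

end

/-! ### The (κ, μ) condition: A² = −κ, and parallelism of A and φ along the leaves. -/

noncomputable section

namespace AlmostCosymplectic

namespace CosymplecticAlgebra

variable {C L : Type*} [CommRing C] [Algebra ℝ C] [AddCommGroup L] [Module C L]
  {G : CosymplecticAlgebra C L}

/-- The `(κ, μ)`-nullity condition, with `h = φ A`. -/
structure IsKappaMu (G : CosymplecticAlgebra C L) (κ μ : C) : Prop where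
  const : ∀ X, G.act X κ = 0
  curvature : ∀ X Y, G.R X Y G.ξ = κ • (G.g Y G.ξ • X - G.g X G.ξ • Y)
    + μ • (G.g Y G.ξ • G.φ (G.A X) - G.g X G.ξ • G.φ (G.A Y))

variable {κ μ : C}

lemma dA_ξ_φ (G : CosymplecticAlgebra C L) (X : L) :
    G.dA G.ξ (G.φ X) = - G.φ (G.dA G.ξ X) := by
  simp only [dA, A_φ, D_neg, D_φ, dφ_ξ, zero_add, map_sub]
  abel

lemma dφ_φ_leaf (G : CosymplecticAlgebra C L) {X Y Z : L} (hY : G.g Y G.ξ = 0)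
    (hZ : G.g Z G.ξ = 0) : G.g (G.dφ X (G.φ Y)) Z = G.g (G.dφ X Y) (G.φ Z) := by
  have h2 := congrArg (fun v => G.g v Z) (G.dφ_φ X Y)
  simp only [map_add, map_smul, LinearMap.add_apply, LinearMap.smul_apply, hY, zero_smul,
    LinearMap.zero_apply, G.symm G.ξ Z, hZ, smul_zero, map_zero] at h2
  linear_combination h2 - G.φ_skew (G.dφ X Y) Z

lemma dφ_add (G : CosymplecticAlgebra C L) (X Y Z : L) :
    G.dφ X (Y + Z) = G.dφ X Y + G.dφ X Z := by
  simp only [dφ, map_add]; abel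

lemma dφ_add_left (G : CosymplecticAlgebra C L) (X Y Z : L) :
    G.dφ (X + Y) Z = G.dφ X Z + G.dφ Y Z := by
  simp only [dφ, map_add, AddMonoidHom.add_apply]; abel

lemma dφ_smul (G : CosymplecticAlgebra C L) (f : C) (X Y : L) :
    G.dφ X (f • Y) = f • G.dφ X Y := by
  simp only [dφ, map_add, map_smul, G.leibniz, smul_sub]; abel

/-- A trilinear form that is symmetric in its first two and skew in its last two arguments
vanishes. -/
lemma eq_zero_of_symm_of_skew {S : Type*} {p : S → S → S → C} (hs : ∀ X Y Z, p X Y Z = p Y X Z)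
    (ha : ∀ X Y Z, p X Y Z = - p X Z Y) (X Y Z : S) : p X Y Z = 0 := by
  refine eq_zero_of_two_mul ?_
  linear_combination ha X Y Z - hs X Z Y - ha Z X Y + hs Z Y X + ha Y Z X - hs Y X Z

namespace IsKappaMu

/-- The curvature condition for R(X, ξ)ξ, expanded with Aξ = 0. -/
lemma riccati (h : G.IsKappaMu κ μ) (X : L) :
    G.dA G.ξ X + G.A (G.A X) + κ • (X - G.g X G.ξ • G.ξ) + μ • G.φ (G.A X) = 0 := by
  have h1 := h.curvature X G.ξ
  simp only [R, br, G.unit, A_ξ, map_sub, AddMonoidHom.sub_apply, ← A_apply, D_A, map_zero,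
    smul_zero] at h1
  have h2 := sub_eq_zero.2 h1
  rw [← neg_eq_zero, ← h2]
  module

/-- In the Riccati equation ∇_ξ A and φA anticommute with φ, while A² and κ commute with it.
Comparing the equation at φX with φ of the equation at X therefore isolates A² + κ. -/
lemma A_sq (h : G.IsKappaMu κ μ) (X : L) : G.A (G.A X) = - κ • (X - G.g X G.ξ • G.ξ) := by
  have h1 := congrArg G.φ (h.riccati X)
  have h2 := h.riccati (G.φ X)
  rw [dA_ξ_φ] at h2
  simp only [map_add, map_sub, map_smul, map_zero, G.φ_ξ, smul_zero, sub_zero, A_φ, map_neg,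
    neg_neg, G.η_φ, zero_smul] at h1 h2
  have key : G.φ (G.A (G.A X) + κ • X) = 0 := by
    refine G.eq_of_g fun Z => (eq_zero_of_two_mul ?_).trans (by simp)
    have e1 := congrArg (fun v => G.g v Z) h1
    have e2 := congrArg (fun v => G.g v Z) h2
    simp only [map_add, map_neg, map_zero, map_smul, LinearMap.add_apply, LinearMap.neg_apply,
      LinearMap.zero_apply, LinearMap.smul_apply, smul_eq_mul] at e1 e2 ⊢
    linear_combination e1 + e2
  have := congrArg G.φ key
  rw [G.φ_sq, map_zero] at this
  simp only [map_add, map_smul, LinearMap.add_apply, LinearMap.smul_apply, η_A, zero_add,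
    smul_eq_mul] at this
  rw [← sub_eq_zero, ← neg_eq_zero, ← this]
  module

lemma g_A_A (h : G.IsKappaMu κ μ) (X Y : L) :
    G.g (G.A X) (G.A Y) = - κ * (G.g X Y - G.g X G.ξ * G.g Y G.ξ) := by
  rw [← A_symm, h.A_sq]
  simp only [map_smul, map_sub, LinearMap.smul_apply, LinearMap.sub_apply, smul_eq_mul,
    G.symm G.ξ Y]

/-! ### Parallelism of `A` and `φ` along the leaves of `η = 0` -/

lemma codazzi (h : G.IsKappaMu κ μ) {X Y : L} (hX : G.g X G.ξ = 0) (hY : G.g Y G.ξ = 0) :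
    G.dA X Y = G.dA Y X := by
  have h1 := h.curvature X Y
  simp only [hX, hY, R, br, map_sub, AddMonoidHom.sub_apply, ← A_apply, D_A, zero_smul,
    sub_zero, smul_zero, add_zero] at h1
  rw [← sub_eq_zero, ← h1]
  abel

/-- Differentiating A² = −κ shows that ∇_X A anticommutes with A up to a multiple of ξ. This is
where the constancy of κ enters. -/
lemma dA_A (h : G.IsKappaMu κ μ) {X Y Z : L} (hY : G.g Y G.ξ = 0) (hZ : G.g Z G.ξ = 0) :
    G.g (G.dA X (G.A Y)) Z = - G.g (G.dA X Y) (G.A Z) := by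
  have h1 : G.dA X (G.A Y) + G.A (G.dA X Y) = (κ * G.g (G.D X Y) G.ξ) • -G.ξ := by
    have e : G.D X (G.A (G.A Y)) = - κ • G.D X Y := by
      rw [h.A_sq, hY, zero_smul, sub_zero, G.leibniz, map_neg, h.const, neg_zero, zero_smul,
        add_zero]
    simp only [dA, map_sub]
    rw [e, h.A_sq]
    module
  have h2 := congrArg (fun v => G.g v Z) h1
  simp only [map_add, map_smul, map_neg, LinearMap.add_apply, LinearMap.smul_apply,
    LinearMap.neg_apply, G.symm G.ξ Z, hZ, neg_zero, smul_zero] at h2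
  rw [← A_symm]
  linear_combination h2

/-- `A` is parallel along the leaves. -/
lemma dA_eq_zero (h : G.IsKappaMu κ μ) {l : C} (hl : l * κ = 1) {X Y Z : L}
    (hX : G.g X G.ξ = 0) (hY : G.g Y G.ξ = 0) (hZ : G.g Z G.ξ = 0) :
    G.g (G.dA X Y) Z = 0 := by
  -- The form g((∇_X A)Y, Z) is totally symmetric on the leaf, and moving A from one slot to another
  -- changes the sign. Three moves bring A back to its first slot with a minus sign. Since A² = −κ
  -- is invertible on the leaf (here `l` is 1/κ), the form itself then vanishes.
  have key {X Y Z : L} (hX : G.g X G.ξ = 0) (hY : G.g Y G.ξ = 0) (hZ : G.g Z G.ξ = 0) :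
      G.g (G.dA (G.A X) Y) Z = 0 := by
    refine eq_zero_of_two_mul ?_
    have s12 {X Y : L} (Z : L) (hX : G.g X G.ξ = 0) (hY : G.g Y G.ξ = 0) :
      G.g (G.dA X Y) Z = G.g (G.dA Y X) Z := by rw [h.codazzi hX hY]
    have s23 (X Y Z : L) : G.g (G.dA X Y) Z = G.g (G.dA X Z) Y := by rw [dA_symm, G.symm]
    have hA (X : L) := G.η_A X
    linear_combination s12 Z (hA X) hY + h.dA_A (X := Y) hX hZ - s23 Y X (G.A Z)
      - s12 X hY (hA Z) - s23 (G.A Z) Y X - s12 Y (hA Z) hX - h.dA_A (X := X) hZ hY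
      + s23 X Z (G.A Y) + s12 Z hX (hA Y) + s23 (G.A Y) X Z + s12 X (hA Y) hZ
      + h.dA_A (X := Z) hY hX - s12 (G.A X) hZ hY - s23 Y Z (G.A X) - s12 Z hY (hA X)
  have := key (G.η_A X) hY hZ
  rw [h.A_sq, hX] at this
  simp only [dA, map_smul, AddMonoidHom.smul_apply, zero_smul, sub_zero, LinearMap.smul_apply,
    map_sub, LinearMap.sub_apply, smul_eq_mul] at this ⊢
  linear_combination -l * this - (G.g (G.D X (G.A Y)) Z - G.g (G.A (G.D X Y)) Z) * hl

/-- Differentiate Aφ + φA = 0 and drop the terms with ∇A, which vanish along the leaves. -/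
lemma dφ_A (h : G.IsKappaMu κ μ) {l : C} (hl : l * κ = 1) {X Y Z : L}
    (hX : G.g X G.ξ = 0) (hY : G.g Y G.ξ = 0) (hZ : G.g Z G.ξ = 0) :
    G.g (G.dφ X (G.A Y)) Z = - G.g (G.dφ X Y) (G.A Z) := by
  have h1 : G.dφ X (G.A Y) + G.A (G.dφ X Y) = - G.dA X (G.φ Y) - G.φ (G.dA X Y) := by
    simp only [dφ, dA, map_sub, A_φ, D_neg]
    abel
  have h2 := congrArg (fun v => G.g v Z) h1
  simp only [map_add, map_sub, map_neg, LinearMap.add_apply, LinearMap.sub_apply,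
    LinearMap.neg_apply] at h2
  linear_combination h2 + G.φ_skew (G.dA X Y) Z * (-1) - G.A_symm (G.dφ X Y) Z
    - h.dA_eq_zero hl hX (G.η_φ Y) hZ + h.dA_eq_zero hl hX hY (G.η_φ Z)

/-- The projections are (1 ± A/l)/2. Here and below `l` is a square root of −κ and `i` is 1/(2l),
both supplied as elements of the ring. -/
lemma exists_eigen_decomposition (h : G.IsKappaMu κ μ) {l i : C} (hl : l * l = - κ)
    (hi : 2 * l * i = 1) {X : L} (hX : G.g X G.ξ = 0) :
    ∃ Y Z : L, G.A Y = l • Y ∧ G.A Z = -l • Z ∧ G.g Y G.ξ = 0 ∧ G.g Z G.ξ = 0 ∧ X = Y + Z := by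
  have hA : G.A (G.A X) = (l * l) • X := by rw [h.A_sq, hX, hl]; simp
  refine ⟨i • (l • X + G.A X), i • (l • X - G.A X), ?_, ?_, ?_, ?_, ?_⟩
  · simp only [map_smul, map_add, hA]; module
  · simp only [map_smul, map_sub, hA]; module
  · simp [hX, η_A]
  · simp [hX, η_A]
  · have : X = (2 * l * i) • X := by rw [hi, one_smul]
    nth_rw 1 [this]
    module

/-- The case of equal eigenvalues. -/
lemma dφ_eigen_same (h : G.IsKappaMu κ μ) {l i : C} (hl : l * l = - κ)
    (hi : 2 * l * i = 1) {X Y W : L} (hX : G.g X G.ξ = 0) (hY : G.g Y G.ξ = 0)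
    (hW : G.g W G.ξ = 0) (aX : G.A X = l • X) (aY : G.A Y = l • Y) (aW : G.A W = l • W) :
    G.g (G.dφ X Y) (G.φ W) = 0 := by
  have hκ : (-4 * i * i) * κ = 1 := by linear_combination (-4 * i * i) * hl + (2 * l * i + 1) * hi
  -- ∇_Z φ anticommutes with A, so it has no component inside an eigenspace.
  have key {X Y Z : L} (hX : G.g X G.ξ = 0) (hY : G.g Y G.ξ = 0) (hZ : G.g Z G.ξ = 0)
      (aX : G.A X = l • X) (aY : G.A Y = l • Y) : G.g (G.dφ Z X) Y = 0 := by
    have := h.dφ_A hκ hZ hX hY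
    rw [aX, aY, dφ_smul] at this
    simp only [map_smul, LinearMap.smul_apply, smul_eq_mul] at this
    linear_combination i * this - G.g (G.dφ Z X) Y * hi
  let S := {X : L // G.g X G.ξ = 0 ∧ G.A X = l • X}
  -- Symmetry in X, Y is dω = 0 with third argument φW, where `key` removes one term. Skewness in Y,
  -- W comes from the skewness of ∇φ and its anticommutation with φ on the leaf.
  refine eq_zero_of_symm_of_skew (S := S)
    (p := fun X Y W => G.g (G.dφ X Y) (G.φ W)) ?_ ?_ ⟨X, hX, aX⟩ ⟨Y, hY, aY⟩ ⟨W, hW, aW⟩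
  · rintro ⟨X, hX, aX⟩ ⟨Y, hY, aY⟩ ⟨W, hW, aW⟩
    have c := G.dφ_cyclic X Y (G.φ W)
    rw [key hX hY (G.η_φ W) aX aY] at c
    linear_combination c - G.dφ_skew Y (G.φ W) X + G.symm (G.φ W) (G.dφ Y X)
  · rintro ⟨X, hX, aX⟩ ⟨Y, hY, aY⟩ ⟨W, hW, aW⟩
    linear_combination - G.dφ_φ_leaf (X := X) hY hW + G.dφ_skew X (G.φ Y) W
      - G.symm (G.φ Y) (G.dφ X W)

/-- φ exchanges the eigenspaces of A, so Z is −φ of the vector φZ in the eigenspace of X and Y. -/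
lemma dφ_eigen_opposite (h : G.IsKappaMu κ μ) {l i : C} (hl : l * l = - κ)
    (hi : 2 * l * i = 1) {X Y Z : L} (hX : G.g X G.ξ = 0) (hY : G.g Y G.ξ = 0)
    (hZ : G.g Z G.ξ = 0) (aX : G.A X = l • X) (aY : G.A Y = l • Y) (aZ : G.A Z = -l • Z) :
    G.g (G.dφ X Y) Z = 0 := by
  have := h.dφ_eigen_same hl hi hX hY (G.η_φ Z) aX aY (by rw [A_φ, aZ]; simp)
  rw [G.φ_sq, hZ] at this
  simpa using this

lemma dφ_eigen (h : G.IsKappaMu κ μ) {l i : C} (hl : l * l = - κ)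
    (hi : 2 * l * i = 1) {X Y Z : L} (hX : G.g X G.ξ = 0) (hY : G.g Y G.ξ = 0)
    (hZ : G.g Z G.ξ = 0) (aX : G.A X = l • X) (aY : G.A Y = l • Y ∨ G.A Y = -l • Y)
    (aZ : G.A Z = l • Z ∨ G.A Z = -l • Z) :
    G.g (G.dφ X Y) Z = 0 := by
  have hκ : (-4 * i * i) * κ = 1 := by linear_combination (-4 * i * i) * hl + (2 * l * i + 1) * hi
  have hA := h.dφ_A hκ hX hY hZ
  rcases aY with aY | aY <;> rcases aZ with aZ | aZ
  · rw [aY, aZ, dφ_smul] at hA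
    simp only [map_smul, LinearMap.smul_apply, smul_eq_mul] at hA
    linear_combination i * hA - G.g (G.dφ X Y) Z * hi
  · exact h.dφ_eigen_opposite hl hi hX hY hZ aX aY aZ
  · rw [dφ_skew, G.symm, h.dφ_eigen_opposite hl hi hX hZ hY aX aZ aY, neg_zero]
  · rw [aY, aZ, dφ_smul] at hA
    simp only [map_smul, LinearMap.smul_apply, smul_eq_mul] at hA
    linear_combination - i * hA - G.g (G.dφ X Y) Z * hi

/-- `φ` is parallel along the leaves. -/
lemma dφ_eq_zero (h : G.IsKappaMu κ μ) {l i : C} (hl : l * l = - κ)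
    (hi : 2 * l * i = 1) {X Y Z : L} (hX : G.g X G.ξ = 0) (hY : G.g Y G.ξ = 0)
    (hZ : G.g Z G.ξ = 0) : G.g (G.dφ X Y) Z = 0 := by
  obtain ⟨X₁, X₂, aX₁, aX₂, hX₁, hX₂, rfl⟩ := h.exists_eigen_decomposition hl hi hX
  obtain ⟨Y₁, Y₂, aY₁, aY₂, hY₁, hY₂, rfl⟩ := h.exists_eigen_decomposition hl hi hY
  obtain ⟨Z₁, Z₂, aZ₁, aZ₂, hZ₁, hZ₂, rfl⟩ := h.exists_eigen_decomposition hl hi hZ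
  have p {Y Z : L} (hY : G.g Y G.ξ = 0) (hZ : G.g Z G.ξ = 0)
      (aY : G.A Y = l • Y ∨ G.A Y = -l • Y) (aZ : G.A Z = l • Z ∨ G.A Z = -l • Z) :
      G.g (G.dφ X₁ Y) Z = 0 ∧ G.g (G.dφ X₂ Y) Z = 0 :=
    ⟨h.dφ_eigen hl hi hX₁ hY hZ aX₁ aY aZ,
      -- Replacing l by −l exchanges the two eigenspaces and reduces X₂ to the case of X₁.
      h.dφ_eigen (l := -l) (i := -i) (by linear_combination hl) (by linear_combination hi)
        hX₂ hY hZ aX₂ (by rw [neg_neg]; exact aY.symm) (by rw [neg_neg]; exact aZ.symm)⟩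
  simp only [dφ_add, dφ_add_left, map_add, LinearMap.add_apply,
    p hY₁ hZ₁ (.inl aY₁) (.inl aZ₁), p hY₂ hZ₁ (.inr aY₂) (.inl aZ₁),
    p hY₁ hZ₂ (.inl aY₁) (.inr aZ₂), p hY₂ hZ₂ (.inr aY₂) (.inr aZ₂), add_zero]

end IsKappaMu

end CosymplecticAlgebra

end AlmostCosymplectic

end

/-! ### Flatness of the leaves and the resulting curvature formulas. -/

noncomputable section

namespace AlmostCosymplectic

namespace CosymplecticAlgebra

variable {C L : Type*} [CommRing C] [Algebra ℝ C] [AddCommGroup L] [Module C L]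
  {G : CosymplecticAlgebra C L}

lemma eq_smul_ξ (G : CosymplecticAlgebra C L) {U : L} (h : ∀ Z, G.g Z G.ξ = 0 → G.g U Z = 0) :
    U = G.g U G.ξ • G.ξ := by
  refine G.eq_of_g fun Z => ?_
  have := h (Z - G.g Z G.ξ • G.ξ) (by simp [G.unit])
  simp only [map_sub, map_smul, smul_eq_mul, LinearMap.smul_apply, G.symm G.ξ Z] at this ⊢
  linear_combination this

lemma η_D (G : CosymplecticAlgebra C L) {Z : L} (hZ : G.g Z G.ξ = 0) (Y : L) :
    G.g (G.D Y Z) G.ξ = - G.g Z (G.A Y) := by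
  have := G.act_η Y Z
  rw [hZ, map_zero] at this
  linear_combination -this

lemma η_br (G : CosymplecticAlgebra C L) {X Y : L} (hX : G.g X G.ξ = 0) (hY : G.g Y G.ξ = 0) :
    G.g (G.br X Y) G.ξ = 0 := by
  simp only [br, map_sub, LinearMap.sub_apply, G.η_D hX, G.η_D hY]
  linear_combination G.symm X (G.A Y) + G.A_symm Y X

lemma R_add (G : CosymplecticAlgebra C L) (X Y Z W : L) :
    G.R X Y (Z + W) = G.R X Y Z + G.R X Y W := by
  simp only [R, map_add]; abel

lemma R_add_left (G : CosymplecticAlgebra C L) (X Y Z W : L) :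
    G.R (X + Y) Z W = G.R X Z W + G.R Y Z W := by
  simp only [R, br, map_add, map_sub, AddMonoidHom.add_apply, AddMonoidHom.sub_apply]; abel

lemma R_add_mid (G : CosymplecticAlgebra C L) (X Y Z W : L) :
    G.R X (Y + Z) W = G.R X Y W + G.R X Z W := by
  rw [R_swap, R_add_left, R_swap, G.R_swap Z X]; abel

lemma R_smul_left (G : CosymplecticAlgebra C L) (f : C) (X Y Z : L) :
    G.R (f • X) Y Z = f • G.R X Y Z := by
  simp only [R, br, map_sub, map_smul, AddMonoidHom.smul_apply, AddMonoidHom.sub_apply, G.leibniz,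
    map_add, AddMonoidHom.add_apply]
  module

/-- The Gauss curvature form of the leaves of `η = 0`. -/
def K (G : CosymplecticAlgebra C L) (X Y Z W : L) : C :=
  G.g (G.R X Y Z) W + G.g (G.A Y) Z * G.g (G.A X) W - G.g (G.A X) Z * G.g (G.A Y) W

lemma K_pair (X Y Z W : L) : G.K X Y Z W = G.K Z W X Y := by
  have e (X Y : L) : G.g (G.A X) Y = G.g (G.A Y) X := by rw [A_symm, G.symm]
  rw [K, K, R_pair, e W X, e Z Y, e Z X, e W Y]
  ring

lemma K_swap (X Y Z W : L) : G.K Y X Z W = - G.K X Y Z W := by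
  rw [K, K, R_swap, map_neg, LinearMap.neg_apply]; ring

lemma K_bianchi (X Y Z W : L) : G.K X Y Z W + G.K Y Z X W + G.K Z X Y W = 0 := by
  have e (X Y : L) : G.g (G.A X) Y = G.g (G.A Y) X := by rw [A_symm, G.symm]
  have b : G.g (G.R X Y Z) W + G.g (G.R Y Z X) W + G.g (G.R Z X Y) W = 0 := by
    rw [← LinearMap.add_apply, ← map_add, ← LinearMap.add_apply, ← map_add, R_bianchi]; simp
  simp only [K]
  rw [e Y X, e Z X, e Z Y]
  linear_combination b

lemma K_add (X Y Z Z' W : L) : G.K X Y (Z + Z') W = G.K X Y Z W + G.K X Y Z' W := by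
  simp only [K, R_add, map_add, LinearMap.add_apply]; ring

lemma K_add_left (X X' Y Z W : L) : G.K (X + X') Y Z W = G.K X Y Z W + G.K X' Y Z W := by
  simp only [K, R_add_left, map_add, LinearMap.add_apply]; ring

lemma K_add_mid (X Y Y' Z W : L) : G.K X (Y + Y') Z W = G.K X Y Z W + G.K X Y' Z W := by
  simp only [K, R_add_mid, map_add, LinearMap.add_apply]; ring

lemma K_smul_right (f : C) (X Y Z W : L) : G.K X Y Z (f • W) = f * G.K X Y Z W := by
  simp only [K, map_smul, smul_eq_mul]; ring

lemma K_skew (X Y Z W : L) : G.K X Y Z W = - G.K X Y W Z := by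
  rw [K, K, R_skew']; ring

namespace IsKappaMu

variable {κ μ l i : C}

omit [Algebra ℝ C] in
lemma inv_of_sqrt (hl : l * l = - κ) (hi : 2 * l * i = 1) : (-4 * i * i) * κ = 1 := by
  linear_combination (-4 * i * i) * hl + (2 * l * i + 1) * hi

/-- Only the ξ-component of ∇A survives, and it is read off from Aξ = 0 and A² = −κ. -/
lemma dA_leaf (h : G.IsKappaMu κ μ) (hl : l * l = - κ) (hi : 2 * l * i = 1) {X Y : L}
    (hX : G.g X G.ξ = 0) (hY : G.g Y G.ξ = 0) : G.dA X Y = (κ * G.g X Y) • G.ξ := by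
  rw [G.eq_smul_ξ fun Z hZ => h.dA_eq_zero (inv_of_sqrt hl hi) hX hY hZ, dA_symm]
  congr 1
  simp only [dA, A_ξ, map_zero, ← A_apply, zero_sub, h.A_sq, hX, zero_smul, sub_zero,
    neg_smul, neg_neg, map_smul, smul_eq_mul, G.symm Y X]

lemma dφ_leaf (h : G.IsKappaMu κ μ) (hl : l * l = - κ) (hi : 2 * l * i = 1) {X Y : L}
    (hX : G.g X G.ξ = 0) (hY : G.g Y G.ξ = 0) : G.dφ X Y = G.g (G.φ (G.A X)) Y • G.ξ := by
  rw [G.eq_smul_ξ fun Z hZ => h.dφ_eq_zero hl hi hX hY hZ, dφ_skew, dφ_ξ_right, map_neg, neg_neg,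
    G.symm]

/-- The Ricci identity for A. The ξ-components of ∇A contribute the right-hand side, which `K_A`
absorbs into the Gauss correction. -/
lemma R_A (h : G.IsKappaMu κ μ) (hl : l * l = - κ) (hi : 2 * l * i = 1) {X Y Z W : L}
    (hX : G.g X G.ξ = 0) (hY : G.g Y G.ξ = 0) (hZ : G.g Z G.ξ = 0) (hW : G.g W G.ξ = 0) :
    G.g (G.R X Y (G.A Z)) W - G.g (G.A (G.R X Y Z)) W =
      κ * (G.g Y Z * G.g (G.A X) W - G.g X Z * G.g (G.A Y) W - G.g X W * G.g Z (G.A Y)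
        + G.g Y W * G.g Z (G.A X)) := by
  have e {X Y : L} (hX : G.g X G.ξ = 0) (hY : G.g Y G.ξ = 0) :
      G.g (G.D X (G.D Y (G.A Z))) W - G.g (G.A (G.D X (G.D Y Z))) W
      = κ * (G.g Y Z * G.g (G.A X) W - G.g X W * G.g Z (G.A Y)) + G.g (G.A (G.D Y Z)) (0 : L) := by
    rw [D_A, h.dA_leaf hl hi hY hZ, map_add, D_A, G.leibniz, ← A_apply]
    simp only [map_add, LinearMap.add_apply, map_smul, LinearMap.smul_apply, smul_eq_mul,
      G.symm G.ξ W, hW]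
    rw [dA_symm, h.dA_leaf hl hi hX hW, map_smul, G.η_D hZ, smul_eq_mul, map_zero]
    ring
  have e3 : G.g (G.D (G.br X Y) (G.A Z)) W = G.g (G.A (G.D (G.br X Y) Z)) W := by
    rw [D_A, map_add, LinearMap.add_apply,
      h.dA_eq_zero (inv_of_sqrt hl hi) (G.η_br hX hY) hZ hW, zero_add]
  have e1 := e hX hY
  have e2 := e hY hX
  simp only [map_zero] at e1 e2
  simp only [R, map_sub, LinearMap.sub_apply]
  linear_combination e1 - e2 - e3

lemma R_φ (h : G.IsKappaMu κ μ) (hl : l * l = - κ) (hi : 2 * l * i = 1) {X Y Z W : L}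
    (hX : G.g X G.ξ = 0) (hY : G.g Y G.ξ = 0) (hZ : G.g Z G.ξ = 0) (hW : G.g W G.ξ = 0) :
    G.g (G.R X Y (G.φ Z)) W - G.g (G.φ (G.R X Y Z)) W =
      G.g (G.φ (G.A Y)) Z * G.g (G.A X) W - G.g (G.φ (G.A X)) Z * G.g (G.A Y) W
        + G.g (G.φ (G.A X)) W * G.g Z (G.A Y) - G.g (G.φ (G.A Y)) W * G.g Z (G.A X) := by
  have e {X Y : L} (hX : G.g X G.ξ = 0) (hY : G.g Y G.ξ = 0) :
      G.g (G.D X (G.D Y (G.φ Z))) W - G.g (G.φ (G.D X (G.D Y Z))) W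
      = G.g (G.φ (G.A Y)) Z * G.g (G.A X) W + G.g (G.φ (G.A X)) W * G.g Z (G.A Y) := by
    rw [D_φ, h.dφ_leaf hl hi hY hZ, map_add, D_φ, G.leibniz, ← A_apply]
    simp only [map_add, LinearMap.add_apply, map_smul, LinearMap.smul_apply, smul_eq_mul,
      G.symm G.ξ W, hW]
    rw [dφ_skew, h.dφ_leaf hl hi hX hW, map_smul, G.η_D hZ, smul_eq_mul]
    ring
  have e3 : G.g (G.D (G.br X Y) (G.φ Z)) W = G.g (G.φ (G.D (G.br X Y) Z)) W := by
    rw [D_φ, map_add, LinearMap.add_apply, h.dφ_eq_zero hl hi (G.η_br hX hY) hZ hW, zero_add]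
  simp only [R, map_sub, LinearMap.sub_apply]
  linear_combination e hX hY - e hY hX - e3

lemma K_A (h : G.IsKappaMu κ μ) (hl : l * l = - κ) (hi : 2 * l * i = 1) {X Y Z W : L}
    (hX : G.g X G.ξ = 0) (hY : G.g Y G.ξ = 0) (hZ : G.g Z G.ξ = 0) (hW : G.g W G.ξ = 0) :
    G.K X Y (G.A Z) W = G.K X Y Z (G.A W) := by
  have := h.R_A hl hi hX hY hZ hW
  rw [A_symm, G.symm Z, G.symm Z] at this
  simp only [K, h.g_A_A, hX, hY, hZ, hW]
  linear_combination this

lemma K_φ (h : G.IsKappaMu κ μ) (hl : l * l = - κ) (hi : 2 * l * i = 1) {X Y Z W : L}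
    (hX : G.g X G.ξ = 0) (hY : G.g Y G.ξ = 0) (hZ : G.g Z G.ξ = 0) (hW : G.g W G.ξ = 0) :
    G.K X Y (G.φ Z) W = - G.K X Y Z (G.φ W) := by
  have := h.R_φ hl hi hX hY hZ hW
  rw [φ_skew, G.symm Z, G.symm Z] at this
  have e (X Y : L) : G.g (G.A X) (G.φ Y) = - G.g (G.φ (G.A X)) Y := by rw [φ_skew, neg_neg]
  simp only [K, e]
  linear_combination this

/-- A can be moved from the third to the fourth slot of K, so the eigenvalues l and −l give lK =
−lK. -/
lemma K_eigen_opposite (h : G.IsKappaMu κ μ) (hl : l * l = - κ) (hi : 2 * l * i = 1)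
    {X Y Z W : L} (hX : G.g X G.ξ = 0) (hY : G.g Y G.ξ = 0) (hZ : G.g Z G.ξ = 0)
    (hW : G.g W G.ξ = 0) (aZ : G.A Z = l • Z) (aW : G.A W = -l • W) : G.K X Y Z W = 0 := by
  have := h.K_A hl hi hX hY hZ hW
  rw [aZ, aW, K_smul_right, K_skew, K_smul_right] at this
  linear_combination i * this - G.K X Y Z W * hi + i * l * G.K_skew X Y Z W

/-- In the Bianchi identity the other two terms each contain a pair of vectors with opposite
eigenvalues, so they vanish by pair symmetry. -/
lemma K_eigen_pair_opposite (h : G.IsKappaMu κ μ) (hl : l * l = - κ) (hi : 2 * l * i = 1)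
    {X Y Z W : L} (hX : G.g X G.ξ = 0) (hY : G.g Y G.ξ = 0) (hZ : G.g Z G.ξ = 0)
    (hW : G.g W G.ξ = 0) (aX : G.A X = l • X) (aY : G.A Y = l • Y) (aZ : G.A Z = -l • Z) :
    G.K X Y Z W = 0 := by
  have b := G.K_bianchi X Y Z W
  rw [K_pair Y, h.K_eigen_opposite hl hi hX hW hY hZ aY aZ, K_swap X Z, K_pair X Z,
    h.K_eigen_opposite hl hi hY hW hX hZ aX aZ] at b
  simpa using b

lemma K_eigen (h : G.IsKappaMu κ μ) (hl : l * l = - κ) (hi : 2 * l * i = 1)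
    {X Y Z W : L} (hX : G.g X G.ξ = 0) (hY : G.g Y G.ξ = 0) (hZ : G.g Z G.ξ = 0)
    (hW : G.g W G.ξ = 0) (aX : G.A X = l • X) (aY : G.A Y = l • Y ∨ G.A Y = -l • Y)
    (aZ : G.A Z = l • Z ∨ G.A Z = -l • Z) : G.K X Y Z W = 0 := by
  rcases aY with aY | aY
  · rcases aZ with aZ | aZ
    -- With all three eigenvalues equal, φ moves Z to the opposite eigenspace, and K(X, Y, φZ, φW) =
    -- K(X, Y, Z, W).
    · have := h.K_eigen_pair_opposite hl hi hX hY (G.η_φ Z) (G.η_φ W) aX aY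
        (by rw [A_φ, aZ, map_smul, neg_smul])
      rw [h.K_φ hl hi hX hY hZ (G.η_φ W), G.φ_sq, hW, zero_smul, add_zero, ← neg_one_smul C W,
        K_smul_right] at this
      simpa using this
    · exact h.K_eigen_pair_opposite hl hi hX hY hZ hW aX aY aZ
  · rw [K_pair, h.K_eigen_opposite hl hi hZ hW hX hY aX aY]

/-- The leaves of `η = 0` are flat. -/
lemma K_eq_zero (h : G.IsKappaMu κ μ) (hl : l * l = - κ) (hi : 2 * l * i = 1)
    {X Y Z W : L} (hX : G.g X G.ξ = 0) (hY : G.g Y G.ξ = 0) (hZ : G.g Z G.ξ = 0)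
    (hW : G.g W G.ξ = 0) : G.K X Y Z W = 0 := by
  obtain ⟨X₁, X₂, aX₁, aX₂, hX₁, hX₂, rfl⟩ := h.exists_eigen_decomposition hl hi hX
  obtain ⟨Y₁, Y₂, aY₁, aY₂, hY₁, hY₂, rfl⟩ := h.exists_eigen_decomposition hl hi hY
  obtain ⟨Z₁, Z₂, aZ₁, aZ₂, hZ₁, hZ₂, rfl⟩ := h.exists_eigen_decomposition hl hi hZ
  have p {Y Z : L} (hY : G.g Y G.ξ = 0) (hZ : G.g Z G.ξ = 0)
      (aY : G.A Y = l • Y ∨ G.A Y = -l • Y) (aZ : G.A Z = l • Z ∨ G.A Z = -l • Z) :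
      G.K (X₁ + X₂) Y Z W = 0 := by
    rw [K_add_left, h.K_eigen hl hi hX₁ hY hZ hW aX₁ aY aZ,
      h.K_eigen (l := -l) (i := -i) (by linear_combination hl) (by linear_combination hi)
        hX₂ hY hZ hW aX₂ (by rw [neg_neg]; exact aY.symm) (by rw [neg_neg]; exact aZ.symm)]
    simp
  simp only [K_add, K_add_mid, p hY₁ hZ₁ (.inl aY₁) (.inl aZ₁),
    p hY₂ hZ₁ (.inr aY₂) (.inl aZ₁), p hY₁ hZ₂ (.inl aY₁) (.inr aZ₂),
    p hY₂ hZ₂ (.inr aY₂) (.inr aZ₂), add_zero]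

/-- Pair symmetry turns R(X, ξ)Y into R(Y, W)ξ, which the nullity condition gives. -/
lemma R_ξ (h : G.IsKappaMu κ μ) (X Y : L) (hY : G.g Y G.ξ = 0) :
    G.R X G.ξ Y = - (κ * G.g Y X + μ * G.g (G.φ (G.A Y)) X) • G.ξ := by
  refine G.eq_of_g fun W => ?_
  rw [R_pair, R_skew', h.curvature, hY]
  simp only [map_sub, map_add, map_smul, smul_eq_mul, LinearMap.smul_apply,
    LinearMap.add_apply, LinearMap.sub_apply, zero_smul, G.symm G.ξ W,
    map_zero, LinearMap.zero_apply]
  ring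

/-- The curvature `R(X, Y)Y` for `Y` tangent to the leaves. -/
lemma R_leaf (h : G.IsKappaMu κ μ) (hl : l * l = - κ) (hi : 2 * l * i = 1) (X : L) {Y : L}
    (hY : G.g Y G.ξ = 0) :
    G.R X Y Y = - G.g (G.A Y) Y • G.A X + G.g (G.A X) Y • G.A Y
      + (G.g X G.ξ * (κ * G.g Y Y + μ * G.g (G.φ (G.A Y)) Y)) • G.ξ := by
  have e {X : L} (hX : G.g X G.ξ = 0) :
      G.R X Y Y = - G.g (G.A Y) Y • G.A X + G.g (G.A X) Y • G.A Y := by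
    rw [← sub_eq_zero, G.eq_smul_ξ (U := G.R X Y Y - _) fun Z hZ => ?_]
    · have : G.g (G.R X Y Y) G.ξ = 0 := by
        rw [R_skew', h.curvature, hX, hY]; simp
      simp [this, η_A]
    · have := h.K_eq_zero hl hi hX hY hY hZ
      simp only [K] at this
      simp only [map_sub, map_add, map_smul, map_neg, smul_eq_mul, LinearMap.smul_apply,
        LinearMap.add_apply, LinearMap.neg_apply, LinearMap.sub_apply, neg_smul]
      linear_combination this
  have hX : G.g (X - G.g X G.ξ • G.ξ) G.ξ = 0 := by simp [G.unit]
  -- The horizontal part of X is governed by flatness of the leaf, the ξ-part by `R_ξ`.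
  have d : X = (X - G.g X G.ξ • G.ξ) + G.g X G.ξ • G.ξ := by abel
  have hA : G.A (X - G.g X G.ξ • G.ξ) = G.A X := by simp [A_ξ]
  conv_lhs => rw [d]
  rw [R_add_left, R_smul_left, e hX, hA, R_swap, h.R_ξ _ _ hY]
  module

end IsKappaMu

end CosymplecticAlgebra

end AlmostCosymplectic

end

/-! ### Smooth fields, their extension from a point, and Ricci as a trace. -/

noncomputable section

namespace AlmostCosymplectic

open CosymplecticAlgebra

variable {m : ℕ} {M : Type*} [TopologicalSpace M]
  [ChartedSpace (EuclideanSpace ℝ (Fin m)) M] [IsManifold (𝓡 m) ∞ M]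

variable (m M) in
/-- Smooth real functions. -/
abbrev SmoothFun := C^∞⟮𝓡 m, M; ℝ⟯

variable (m M) in
/-- Smooth vector fields. -/
abbrev SmoothField := Cₛ^∞⟮𝓡 m; EuclideanSpace ℝ (Fin m), fun x : M => TangentSpace (𝓡 m) x⟯

instance : SMul (SmoothFun m M) (SmoothField m M) where
  smul f X := ⟨fun x => f x • X x, f.contMDiff.smul_section X.contMDiff⟩

@[simp] lemma SmoothField.smul_apply (f : SmoothFun m M) (X : SmoothField m M) (x : M) :
    (f • X) x = f x • X x := rfl

instance : Module (SmoothFun m M) (SmoothField m M) where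
  one_smul X := by ext x; simp
  mul_smul f g X := by ext x; simp [mul_smul]
  smul_zero f := by ext x; simp
  smul_add f X Y := by ext x; simp
  add_smul f g X := by ext x; simp [add_smul]
  zero_smul X := by ext x; simp

lemma SmoothField.smooth (X : SmoothField m M) : SmoothVField X := X.contMDiff

/-- The smooth vector field given by a family of tangent vectors. -/
def SmoothVField.toField {X : VField m M} (hX : SmoothVField X) : SmoothField m M := ⟨X, hX⟩

@[simp] lemma SmoothVField.toField_apply {X : VField m M} (hX : SmoothVField X) (x : M) :
    hX.toField x = X x := rfl

lemma SmoothField.mdiffAt (X : SmoothField m M) (x : M) :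
    MDifferentiableAt (𝓡 m) ((𝓡 m).prod 𝓘(ℝ, EuclideanSpace ℝ (Fin m)))
      (fun x => Bundle.TotalSpace.mk' (EuclideanSpace ℝ (Fin m)) x (X x)) x :=
  (X.contMDiff x).mdifferentiableAt (by simp)

omit [IsManifold (𝓡 m) ∞ M] in
lemma SmoothFun.mdiffAt (f : SmoothFun m M) (x : M) : MDifferentiableAt (𝓡 m) 𝓘(ℝ, ℝ) f x :=
  (f.contMDiff x).mdifferentiableAt (by simp)

lemma smooth_dirDeriv {X : VField m M} (hX : SmoothVField X) {f : M → ℝ}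
    (hf : ContMDiff (𝓡 m) 𝓘(ℝ, ℝ) ∞ f) : ContMDiff (𝓡 m) 𝓘(ℝ, ℝ) ∞ (dirDeriv X f) := by
  have h := (hf.contMDiff_tangentMap (m := ∞) (by simp)).comp hX
  exact (contMDiff_snd_tangentBundle_modelSpace ℝ 𝓘(ℝ, ℝ)).comp h

lemma SmoothEndoField.smooth_app {φ : EndoField m M} (hφ : SmoothEndoField φ) {X : VField m M}
    (hX : SmoothVField X) : SmoothVField (φ.app X) :=
  ContMDiff.clm_bundle_apply hφ hX

lemma SmoothOneForm.smooth_apply {θ : OneForm m M} (hθ : SmoothOneForm θ) {X : VField m M}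
    (hX : SmoothVField X) : ContMDiff (𝓡 m) 𝓘(ℝ, ℝ) ∞ (fun x => θ x (X x)) := by
  have := ContMDiff.clm_bundle_apply (F₁ := EuclideanSpace ℝ (Fin m)) (F₂ := ℝ)
    (E₁ := fun x : M => TangentSpace (𝓡 m) x) (E₂ := Bundle.Trivial M ℝ) hθ hX
  exact fun x => (Bundle.contMDiffAt_section x).1 (this x)

lemma smooth_inner (g : Metric m M) {X Y : VField m M} (hX : SmoothVField X)
    (hY : SmoothVField Y) : ContMDiff (𝓡 m) 𝓘(ℝ, ℝ) ∞ (fun x => g.inner x (X x) (Y x)) := by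
  have := ContMDiff.clm_bundle_apply₂ (F₁ := EuclideanSpace ℝ (Fin m))
    (F₂ := EuclideanSpace ℝ (Fin m)) (F₃ := ℝ)
    (E₁ := fun x : M => TangentSpace (𝓡 m) x) (E₂ := fun x : M => TangentSpace (𝓡 m) x)
    (E₃ := Bundle.Trivial M ℝ) g.contMDiff hX hY
  exact fun x => (Bundle.contMDiffAt_section x).1 (this x)

lemma smooth_covDeriv {D : Connection m M}
    (hD : CovariantDerivative.ContMDiffCovariantDerivative D ∞) {X Y : VField m M}
    (hX : SmoothVField X) (hY : SmoothVField Y) : SmoothVField (covDeriv D X Y) := by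
  have h := hD.contMDiff.contMDiff (σ := Y) (by simpa using hY.contMDiffOn)
  exact ContMDiff.clm_bundle_apply (contMDiffOn_univ.1 h) hX

/-! ### Extension of tangent vectors to smooth vector fields -/

open Filter Topology

/-- The extension used by `ricci` is smooth only near x. Cutting it off with a bump function gives a
global smooth field with the same germ, which is all that the curvature at x depends on. -/
lemma exists_field_eventuallyEq_extend [T2Space M] (x : M) (v : TangentSpace (𝓡 m) x) :
    ∃ X : SmoothField m M,
      ∀ᶠ y in 𝓝 x, X y = FiberBundle.extend (EuclideanSpace ℝ (Fin m)) v y := by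
  obtain ⟨s, hs, hsm⟩ := FiberBundle.exists_contMDiffOn_extend (𝓡 m) (EuclideanSpace ℝ (Fin m)) (k := ∞) v
  obtain ⟨χ, -, hχ⟩ := (SmoothBumpFunction.nhds_basis_tsupport (I := 𝓡 m) x).mem_iff.1
    (interior_mem_nhds.2 hs)
  refine ⟨⟨fun y => χ y • FiberBundle.extend (EuclideanSpace ℝ (Fin m)) v y, fun y => ?_⟩, ?_⟩
  · by_cases hy : y ∈ tsupport χ
    · exact (χ.contMDiff y).smul_section
        (hsm.contMDiffAt (mem_interior_iff_mem_nhds.1 (hχ hy)))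
    · have h0 := Bundle.contMDiff_zeroSection ℝ (fun x : M => TangentSpace (𝓡 m) x)
        (IB := 𝓡 m) (F := EuclideanSpace ℝ (Fin m)) (n := ∞) y
      refine h0.congr_of_eventuallyEq ?_
      filter_upwards [notMem_tsupport_iff_eventuallyEq.1 hy] with z hz
      simp only [hz, Pi.zero_apply, zero_smul]
      rfl
  · filter_upwards [χ.eventuallyEq_one] with y hy
    change χ y • FiberBundle.extend (EuclideanSpace ℝ (Fin m)) v y = _
    rw [hy, Pi.one_apply, one_smul]

lemma exists_field [T2Space M] (x : M) (v : TangentSpace (𝓡 m) x) :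
    ∃ X : SmoothField m M, X x = v := by
  obtain ⟨X, hX⟩ := exists_field_eventuallyEq_extend x v
  exact ⟨X, by rw [hX.self_of_nhds, FiberBundle.extend_apply_self]⟩

omit [IsManifold (𝓡 m) ∞ M] in
lemma bracket_eventuallyEq {X X' Y Y' : VField m M} {x : M} (hX : ∀ᶠ y in 𝓝 x, X y = X' y)
    (hY : ∀ᶠ y in 𝓝 x, Y y = Y' y) : bracket X Y x = bracket X' Y' x :=
  EventuallyEq.mlieBracket_vectorField_eq hX hY

lemma covDeriv_eventuallyEq (D : Connection m M) {X Y Y' : VField m M} {x : M}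
    (hY : MDifferentiableAt (𝓡 m) ((𝓡 m).prod 𝓘(ℝ, EuclideanSpace ℝ (Fin m)))
      (fun x => Bundle.TotalSpace.mk' (EuclideanSpace ℝ (Fin m)) x (Y x)) x)
    (hYY' : ∀ᶠ y in 𝓝 x, Y y = Y' y) : covDeriv D X Y x = covDeriv D X Y' x := by
  have hY' : MDifferentiableAt (𝓡 m) ((𝓡 m).prod 𝓘(ℝ, EuclideanSpace ℝ (Fin m)))
      (fun x => Bundle.TotalSpace.mk' (EuclideanSpace ℝ (Fin m)) x (Y' x)) x :=
    hY.congr_of_eventuallyEq (hYY'.mono fun y hy => by simp only [hy])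
  exact congrArg (fun T => T (X x)) (D.isCovariantDerivativeOn.congr_of_eventuallyEq hY hY'
    univ_mem hYY')

lemma curvature_eventuallyEq {D : Connection m M}
    (hD : CovariantDerivative.ContMDiffCovariantDerivative D ∞) {X X' Y Z : VField m M} {x : M}
    (hX : SmoothVField X) (hZ : SmoothVField Z) (hXX' : ∀ᶠ y in 𝓝 x, X y = X' y) :
    curvature D X Y Z x = curvature D X' Y Z x := by
  have hx := hXX'.self_of_nhds
  have h1 : covDeriv D Y (covDeriv D X Z) x = covDeriv D Y (covDeriv D X' Z) x :=
    covDeriv_eventuallyEq D ((smooth_covDeriv hD hX hZ x).mdifferentiableAt (by simp))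
      (hXX'.mono fun y hy => by simp only [covDeriv, hy])
  have h2 : bracket X Y x = bracket X' Y x :=
    bracket_eventuallyEq hXX' (Eventually.of_forall fun _ => rfl)
  unfold curvature
  rw [h1]
  simp only [covDeriv, h2, hx]

variable (m) in
/-- The basis of the tangent space used in the definition of `ricci`. -/
def tangentBasis (x : M) : Module.Basis (Fin m) ℝ (TangentSpace (𝓡 m) x) :=
  (EuclideanSpace.basisFun (Fin m) ℝ).toBasis

lemma ricci_eq_sum [T2Space M] {D : Connection m M}
    (hD : CovariantDerivative.ContMDiffCovariantDerivative D ∞) {Y Z : VField m M}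
    (hZ : SmoothVField Z) (x : M) (E : Fin m → SmoothField m M)
    (hE : ∀ i, ∀ᶠ y in 𝓝 x,
      E i y = FiberBundle.extend (EuclideanSpace ℝ (Fin m)) (tangentBasis m x i) y) :
    ricci D Y Z x = ∑ i, (tangentBasis m x).coord i (curvature D (E i) Y Z x) := by
  refine Finset.sum_congr rfl fun i _ => ?_
  rw [curvature_eventuallyEq hD (E i).smooth hZ (hE i)]
  rfl

/-- If a combination of the curvature operators `v ↦ R(v, Y)Z` of several connections is given at
`x` by a linear map `τ`, then the same combination of the Ricci tensors is the trace of `τ`. -/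
lemma sum_ricci_eq_trace [T2Space M] {ι : Type*} (s : Finset ι) (c : ι → ℝ)
    {D : ι → Connection m M}
    (hD : ∀ j, CovariantDerivative.ContMDiffCovariantDerivative (D j) ∞) {Y Z : ι → VField m M}
    (hZ : ∀ j, SmoothVField (Z j)) (x : M)
    (τ : TangentSpace (𝓡 m) x →ₗ[ℝ] TangentSpace (𝓡 m) x)
    (hτ : ∀ X : SmoothField m M, ∑ j ∈ s, c j • curvature (D j) X (Y j) (Z j) x = τ (X x)) :
    ∑ j ∈ s, c j * ricci (D j) (Y j) (Z j) x = LinearMap.trace ℝ _ τ := by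
  choose E hE using fun i => exists_field_eventuallyEq_extend x (tangentBasis m x i)
  have hEx (i) : E i x = tangentBasis m x i := by
    rw [(hE i).self_of_nhds, FiberBundle.extend_apply_self]
  have h2 (i) : ∑ j ∈ s, c j * (tangentBasis m x).coord i
      (curvature (D j) (E i) (Y j) (Z j) x) = (tangentBasis m x).coord i
        (τ (tangentBasis m x i)) := by
    rw [← hEx, ← hτ, map_sum]
    simp only [map_smul, smul_eq_mul]
  simp only [fun j => ricci_eq_sum (hD j) (Y := Y j) (hZ j) x E hE, Finset.mul_sum]
  rw [Finset.sum_comm, Finset.sum_congr rfl fun i _ => h2 i,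
    LinearMap.trace_eq_matrix_trace ℝ (tangentBasis m x)]
  simp only [Matrix.trace, Matrix.diag_apply, LinearMap.toMatrix_apply, Module.Basis.coord_apply]

end AlmostCosymplectic

end

/-! ### Realization of the formal calculus by smooth fields. -/

noncomputable section

namespace AlmostCosymplectic

open CosymplecticAlgebra

variable {m : ℕ} {M : Type*} [TopologicalSpace M]
  [ChartedSpace (EuclideanSpace ℝ (Fin m)) M] [IsManifold (𝓡 m) ∞ M]

/-! ### The algebra of smooth fields -/

variable (m M) in
/-- Smooth vector fields as derivations. -/
def actField : SmoothField m M →ₗ[SmoothFun m M] Derivation ℝ (SmoothFun m M) (SmoothFun m M) where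
  toFun X := Derivation.mk'
    { toFun := fun f => ⟨dirDeriv X f, smooth_dirDeriv X.smooth f.contMDiff⟩
      map_add' := fun f g => by
        ext x
        exact congrArg (fun T => T (X x)) (mvfderiv_add (f.mdiffAt x) (g.mdiffAt x))
      map_smul' := fun c f => by
        ext x
        have := mvfderiv_smul (a := fun _ => c) (x := x)
          (mdifferentiableAt_const (I := 𝓡 m) (I' := 𝓘(ℝ, ℝ))) (f.mdiffAt x)
        rw [mvfderiv_const] at this
        simpa using! congrArg (fun T => T (X x)) this }
    fun f g => by
      ext x
      exact congrArg (fun T => T (X x)) (mvfderiv_mul (f.mdiffAt x) (g.mdiffAt x))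
  map_add' X Y := by
    ext f x
    exact map_add (mvfderiv (𝓡 m) f x) (X x) (Y x)
  map_smul' a X := by
    ext f x
    exact map_smul (mvfderiv (𝓡 m) f x) (a x) (X x)

/-- A smooth connection as an operator on smooth fields. -/
def connField (D : Connection m M)
    (hD : CovariantDerivative.ContMDiffCovariantDerivative D ∞) :
    SmoothField m M →ₗ[SmoothFun m M] SmoothField m M →+ SmoothField m M where
  toFun X := AddMonoidHom.mk' (fun Y => (smooth_covDeriv hD X.smooth Y.smooth).toField) fun Y Z => by
    ext x : 1
    exact congrArg (fun T => T (X x))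
      (D.isCovariantDerivativeOn.add (Y.mdiffAt x) (Z.mdiffAt x) (Set.mem_univ x))
  map_add' X Y := by
    ext Z x : 2
    exact map_add (D Z x) (X x) (Y x)
  map_smul' a X := by
    ext Z x : 2
    exact map_smul (D Z x) (a x) (X x)

section
variable (D : Connection m M) (hD : CovariantDerivative.ContMDiffCovariantDerivative D ∞)

lemma connField_leibniz (X : SmoothField m M) (f : SmoothFun m M) (Y : SmoothField m M) :
    connField D hD X (f • Y) = f • connField D hD X Y + actField m M X f • Y := by
  ext x : 1
  exact congrArg (fun T => T (X x))
    (D.isCovariantDerivativeOn.leibniz (Y.mdiffAt x) (f.mdiffAt x) (Set.mem_univ x))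

end

lemma coe_bracket {D : Connection m M} (hD : IsTorsionFree D) (X Y : SmoothField m M) :
    ⇑(connField D hD.smooth X Y - connField D hD.smooth Y X) = bracket X Y :=
  funext fun x => hD.torsion_free X Y X.smooth Y.smooth x

lemma connField_jacobi {D : Connection m M} (hD : IsTorsionFree D) (X Y Z : SmoothField m M) :
    (connField D hD.smooth X (connField D hD.smooth Y Z - connField D hD.smooth Z Y)
        - connField D hD.smooth (connField D hD.smooth Y Z - connField D hD.smooth Z Y) X)
      = (connField D hD.smooth (connField D hD.smooth X Y - connField D hD.smooth Y X) Z
        - connField D hD.smooth Z (connField D hD.smooth X Y - connField D hD.smooth Y X))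
      + (connField D hD.smooth Y (connField D hD.smooth X Z - connField D hD.smooth Z X)
        - connField D hD.smooth (connField D hD.smooth X Z - connField D hD.smooth Z X) Y) := by
  have hM : IsManifold (𝓡 m) (minSmoothness ℝ 3) M :=
    IsManifold.of_le (n := ∞)
      (by simp only [minSmoothness_of_isRCLikeNormedField]; exact ENat.LEInfty.out)
  have hle (X : SmoothField m M) := X.contMDiff.of_le (m := minSmoothness ℝ 2)
    (by simp only [minSmoothness_of_isRCLikeNormedField]; exact ENat.LEInfty.out)
  ext x : 1
  rw [ContMDiffSection.coe_add, Pi.add_apply]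
  simp only [coe_bracket hD]
  exact VectorField.leibniz_identity_mlieBracket_apply (hle X x) (hle Y x) (hle Z x)

/-- A Riemannian metric as a bilinear form on smooth fields. -/
def metricField (g : Metric m M) :
    SmoothField m M →ₗ[SmoothFun m M] SmoothField m M →ₗ[SmoothFun m M] SmoothFun m M where
  toFun X :=
    { toFun := fun Y => ⟨fun x => g.inner x (X x) (Y x), smooth_inner g X.smooth Y.smooth⟩
      map_add' := fun Y Z => by ext x; exact map_add (g.inner x (X x)) (Y x) (Z x)
      map_smul' := fun f Y => by ext x; exact map_smul (g.inner x (X x)) (f x) (Y x) }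
  map_add' X Y := by
    ext Z x
    exact congrArg (fun T => T (Z x)) (map_add (g.inner x) (X x) (Y x))
  map_smul' f X := by
    ext Z x
    exact congrArg (fun T => T (Z x)) (map_smul (g.inner x) (f x) (X x))

@[simp] lemma metricField_apply (g : Metric m M) (X Y : SmoothField m M) (x : M) :
    metricField g X Y x = g.inner x (X x) (Y x) := rfl

/-- A smooth field of endomorphisms as an operator on smooth fields. -/
def endoField {φ : EndoField m M} (hφ : SmoothEndoField φ) :
    SmoothField m M →ₗ[SmoothFun m M] SmoothField m M where
  toFun X := (hφ.smooth_app X.smooth).toField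
  map_add' X Y := by ext x : 1; exact map_add (φ x) (X x) (Y x)
  map_smul' f X := by ext x : 1; exact map_smul (φ x) (f x) (X x)

@[simp] lemma endoField_apply {φ : EndoField m M} (hφ : SmoothEndoField φ) (X : SmoothField m M)
    (x : M) : endoField hφ X x = φ x (X x) := rfl

lemma metric_eq_zero (g : Metric m M) {x : M} {v : TangentSpace (𝓡 m) x}
    (h : g.inner x v v = 0) : v = 0 := by
  by_contra hv
  exact (g.pos x v hv).ne' h

lemma metricField_definite (g : Metric m M) (X : SmoothField m M) (h : metricField g X X = 0) :
    X = 0 := by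
  ext x : 1
  exact metric_eq_zero g (congrArg (fun f => f x) h)

namespace AlmostContactMetric

variable (S : AlmostContactMetric m M) {nabla : Connection m M}

/-- The algebra of smooth fields on an almost cosymplectic manifold. -/
@[simps]
def toAlgebra (hn : IsLeviCivita S.g nabla) (hS : S.IsAlmostCosymplectic) :
    CosymplecticAlgebra (SmoothFun m M) (SmoothField m M) where
  act := actField m M
  D := connField nabla hn.smooth
  g := metricField S.g
  φ := endoField S.smooth_φ
  ξ := SmoothVField.toField S.smooth_ξ
  leibniz := connField_leibniz nabla hn.smooth
  jacobi := connField_jacobi hn.toIsTorsionFree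
  symm X Y := by ext x; exact S.g.symm ..
  definite := metricField_definite S.g
  metric X Y Z := by
    ext x
    have := hn.metric Y Z X Y.smooth Z.smooth X.smooth x
    unfold covDerivMetric at this
    exact sub_eq_zero.1 ((sub_sub _ _ _).symm.trans this)
  unit := by ext x; exact (S.g_ξ _ _).trans (S.η_ξ x)
  φ_sq X := by
    ext x : 1
    refine (S.φ_sq x (X x)).trans ?_
    rw [← S.g_ξ]
    rfl
  η_φ X := by ext x; exact (S.g_ξ _ _).trans (S.η_φ ..)
  φ_ξ := by ext x : 1; exact S.φ_ξ x
  compatible X Y := by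
    ext x
    refine (S.compatible ..).trans ?_
    rw [← S.g_ξ, ← S.g_ξ]
    rfl
  closed_η X Y := by
    ext x
    have := hS.closed_η X Y X.smooth Y.smooth x
    unfold extDerivOne at this
    simp only [← S.g_ξ] at this
    rw [← coe_bracket hn.toIsTorsionFree] at this
    exact this
  closed_ω X Y Z := by
    ext x
    have := hS.closed_fundForm X Y Z X.smooth Y.smooth Z.smooth x
    unfold extDerivTwo at this
    simp only [← coe_bracket hn.toIsTorsionFree] at this
    exact this

variable {S}

/-- The tensor `h` of an almost cosymplectic structure is `φ ∘ ∇ξ`. -/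
lemma h_eq (hn : IsLeviCivita S.g nabla) (hS : S.IsAlmostCosymplectic) (X : SmoothField m M)
    (x : M) : S.h X x = S.φ x (nabla S.ξ x (X x)) := by
  have := congrArg (fun Y : SmoothField m M => Y x) ((S.toAlgebra hn hS).two_h X)
  have e (X Y : SmoothField m M) : ⇑((S.toAlgebra hn hS).br X Y) = bracket X Y :=
    coe_bracket hn.toIsTorsionFree X Y
  simp only [toAlgebra_φ, toAlgebra_ξ] at this e
  unfold AlmostContactMetric.h
  have h2 : bracket S.ξ (EndoField.app S.φ X) x - S.φ x (bracket S.ξ X x)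
      = (2 : ℝ) • S.φ x (nabla S.ξ x (X x)) := by
    refine Eq.trans ?_ (this.trans ?_)
    · rw [ContMDiffSection.coe_sub, Pi.sub_apply, endoField_apply, e, e]
      rfl
    · rw [SmoothField.smul_apply]
      congr 1
      exact (congrArg (fun f : SmoothFun m M => f x) one_add_one_eq_two.symm).trans
        (one_add_one_eq_two (R := ℝ))
  rw [h2, smul_smul]
  norm_num

lemma coe_R (hn : IsLeviCivita S.g nabla) (hS : S.IsAlmostCosymplectic)
    (X Y Z : SmoothField m M) (x : M) :
    (S.toAlgebra hn hS).R X Y Z x = curvature nabla X Y Z x := by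
  unfold curvature covDeriv
  rw [← coe_bracket hn.toIsTorsionFree]
  rfl

/-- The identity h = φ∇ξ turns the geometric nullity condition into the formal one. -/
lemma IsKappaMu.toAlgebra {κ μ : ℝ} (hn : IsLeviCivita S.g nabla) (h : S.IsKappaMu nabla κ μ) :
    (S.toAlgebra hn h.toIsAlmostCosymplectic).IsKappaMu (algebraMap ℝ _ κ) (algebraMap ℝ _ μ) where
  const X := Derivation.map_algebraMap ..
  curvature X Y := by
    ext x : 1
    have := h.curvature_ξ X Y X.smooth Y.smooth x
    rw [h_eq hn h.toIsAlmostCosymplectic, h_eq hn h.toIsAlmostCosymplectic] at this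
    simp only [← S.g_ξ] at this
    refine (coe_R hn h.toIsAlmostCosymplectic X Y _ x).trans (this.trans ?_)
    rfl

end AlmostContactMetric

end AlmostCosymplectic

end

/-! ### The Ricci tensor of a (κ, μ)-structure. -/

noncomputable section

namespace AlmostCosymplectic

open CosymplecticAlgebra

variable {m : ℕ} {M : Type*} [TopologicalSpace M]
  [ChartedSpace (EuclideanSpace ℝ (Fin m)) M] [IsManifold (𝓡 m) ∞ M]

omit [IsManifold (𝓡 m) ∞ M] in
lemma trace_tangent_smulRight {x : M} (α : TangentSpace (𝓡 m) x →ₗ[ℝ] ℝ)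
    (v : TangentSpace (𝓡 m) x) : LinearMap.trace ℝ _ (α.smulRight v) = α v := by
  have := Module.Free.of_basis (tangentBasis m x)
  have := Module.Finite.of_basis (tangentBasis m x)
  exact LinearMap.trace_smulRight α v

omit [IsManifold (𝓡 m) ∞ M] in
lemma trace_tangent_id (x : M) :
    LinearMap.trace ℝ _ (LinearMap.id : TangentSpace (𝓡 m) x →ₗ[ℝ] _) = m := by
  have := Module.Free.of_basis (tangentBasis m x)
  have := Module.Finite.of_basis (tangentBasis m x)
  rw [LinearMap.trace_id, Module.finrank_eq_card_basis (tangentBasis m x), Fintype.card_fin]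

lemma ricci_eq_trace [T2Space M] {D : Connection m M}
    (hD : CovariantDerivative.ContMDiffCovariantDerivative D ∞) (Y Z : SmoothField m M) (x : M)
    (τ : TangentSpace (𝓡 m) x →ₗ[ℝ] TangentSpace (𝓡 m) x)
    (hτ : ∀ X : SmoothField m M, curvature D X Y Z x = τ (X x)) :
    ricci D Y Z x = LinearMap.trace ℝ _ τ := by
  simpa using sum_ricci_eq_trace (Finset.univ : Finset (Fin 1)) (fun _ => 1) (fun _ => hD)
    (Y := fun _ => Y) (fun _ => Z.smooth) x τ (by simpa using hτ)

/-- The linear form `g(v, ·)`. -/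
def flat (g : Metric m M) {x : M} (v : TangentSpace (𝓡 m) x) : TangentSpace (𝓡 m) x →ₗ[ℝ] ℝ :=
  (g.inner x v).toLinearMap

@[simp] lemma flat_apply (g : Metric m M) {x : M} (v w : TangentSpace (𝓡 m) x) :
    flat g v w = g.inner x v w := rfl

namespace AlmostContactMetric

variable {S : AlmostContactMetric m M} {nabla : Connection m M}

variable (S nabla) in
/-- The endomorphism `∇ξ` of `T_x M`. -/
def A (x : M) : TangentSpace (𝓡 m) x →ₗ[ℝ] TangentSpace (𝓡 m) x :=
  (nabla S.ξ x).toLinearMap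

variable (S) in
/-- The endomorphism `φ` of `T_x M`. -/
def Φ (x : M) : TangentSpace (𝓡 m) x →ₗ[ℝ] TangentSpace (𝓡 m) x := (S.φ x).toLinearMap

section
variable [T2Space M] (hn : IsLeviCivita S.g nabla) (hS : S.IsAlmostCosymplectic)
include hn hS

lemma A_comp_Φ (x : M) : S.A nabla x ∘ₗ S.Φ x = - (S.Φ x ∘ₗ S.A nabla x) := by
  ext1 v
  obtain ⟨X, rfl⟩ := exists_field x v
  exact congrArg (fun W : SmoothField m M => W x) ((S.toAlgebra hn hS).A_φ X)

lemma η_A_apply {x : M} (v : TangentSpace (𝓡 m) x) : S.η x (S.A nabla x v) = 0 := by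
  obtain ⟨X, rfl⟩ := exists_field x v
  rw [← S.g_ξ]
  exact congrArg (fun f : SmoothFun m M => f x) ((S.toAlgebra hn hS).η_A X)

lemma trace_Φ_A (x : M) : LinearMap.trace ℝ _ (S.Φ x ∘ₗ S.A nabla x) = 0 := by
  have h := LinearMap.trace_mul_comm ℝ (S.Φ x) (S.A nabla x)
  have h2 : S.A nabla x * S.Φ x = - (S.Φ x * S.A nabla x) := A_comp_Φ hn hS x
  rw [h2, map_neg] at h
  change LinearMap.trace ℝ _ (S.Φ x * S.A nabla x) = 0
  linarith

/-- Here A = −φ(φA), and cycling the trace together with Aφ = −φA gives tr A = −tr A. -/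
lemma trace_A (x : M) : LinearMap.trace ℝ _ (S.A nabla x) = 0 := by
  have h := LinearMap.trace_mul_comm ℝ (S.Φ x) (S.Φ x * S.A nabla x)
  have h2 : S.A nabla x * S.Φ x = - (S.Φ x * S.A nabla x) := A_comp_Φ hn hS x
  have h3 : S.Φ x * (S.Φ x * S.A nabla x) = - S.A nabla x := by
    ext1 v
    refine (S.φ_sq x _).trans ?_
    have := η_A_apply hn hS v
    rw [this, zero_smul, add_zero]
    rfl
  rw [mul_assoc, h2, mul_neg, h3, neg_neg, map_neg] at h
  linarith

end

namespace IsKappaMu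

variable [T2Space M] {κ μ : ℝ} (hn : IsLeviCivita S.g nabla) (h : S.IsKappaMu nabla κ μ)
include hn h

/-- `Ric(Y, ξ) = (m - 1) κ η(Y)` in dimension `m`. -/
lemma ricci_ξ (Y : SmoothField m M) (x : M) :
    ricci nabla Y S.ξ x = (m - 1) * κ * S.η x (Y x) := by
  have hS := h.toIsAlmostCosymplectic
  have e := ricci_eq_trace hn.smooth Y (SmoothVField.toField S.smooth_ξ) x
    (κ • (S.η x (Y x) • LinearMap.id - (flat S.g (S.ξ x)).smulRight (Y x))
      + μ • (S.η x (Y x) • (S.Φ x ∘ₗ S.A nabla x)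
        - (flat S.g (S.ξ x)).smulRight (S.Φ x (S.A nabla x (Y x))))) fun X => by
      refine (h.curvature_ξ X Y X.smooth Y.smooth x).trans ?_
      rw [h_eq hn hS, h_eq hn hS, ← S.g_ξ _ (X x), S.g.symm]
      rfl
  refine e.trans ?_
  simp only [map_add, map_sub, map_smul, trace_tangent_smulRight, trace_tangent_id,
    trace_Φ_A hn hS, flat_apply, smul_eq_mul]
  rw [S.g.symm, S.g_ξ, S.g.symm, S.g_ξ]
  have : S.η x (S.Φ x (S.A nabla x (Y x))) = 0 := S.η_φ ..
  rw [this]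
  ring

/-- `Ric(ξ, Y) = 0` for `Y` orthogonal to `ξ`. -/
lemma ricci_ξ_left (Y : SmoothField m M) (hY : ∀ x, S.η x (Y x) = 0) (x : M) :
    ricci nabla S.ξ Y x = 0 := by
  have hS := h.toIsAlmostCosymplectic
  have hY' : metricField S.g Y (SmoothVField.toField S.smooth_ξ) = 0 := by
    ext x; exact (S.g_ξ ..).trans (hY x)
  have e := ricci_eq_trace hn.smooth (SmoothVField.toField S.smooth_ξ) Y x
    ((-(κ • flat S.g (Y x) + μ • flat S.g (S.Φ x (S.A nabla x (Y x))))).smulRight (S.ξ x))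
    fun X => by
      rw [← coe_R hn hS]
      exact congrArg (fun W : SmoothField m M => W x) ((h.toAlgebra hn).R_ξ X Y hY')
  refine e.trans ?_
  rw [trace_tangent_smulRight]
  simp only [LinearMap.neg_apply, LinearMap.add_apply, LinearMap.smul_apply, flat_apply, S.g_ξ, hY,
    smul_eq_mul]
  have : S.η x (S.Φ x (S.A nabla x (Y x))) = 0 := S.η_φ ..
  rw [this]
  ring

lemma inner_A_A (x : M) (v : TangentSpace (𝓡 m) x) (hv : S.η x v = 0) :
    S.g.inner x (S.A nabla x v) (S.A nabla x v) = - κ * S.g.inner x v v := by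
  obtain ⟨X, rfl⟩ := exists_field x v
  have := congrArg (fun f : SmoothFun m M => f x) ((h.toAlgebra hn).g_A_A X X)
  refine this.trans ?_
  change -κ * (S.g.inner x (X x) (X x) - S.g.inner x (X x) (S.ξ x) * S.g.inner x (X x) (S.ξ x)) = _
  rw [S.g_ξ, hv]
  ring

lemma inner_A (x : M) (v w : TangentSpace (𝓡 m) x) :
    S.g.inner x (S.A nabla x v) w = S.g.inner x v (S.A nabla x w) := by
  have hS := h.toIsAlmostCosymplectic
  obtain ⟨X, rfl⟩ := exists_field x v
  obtain ⟨Y, rfl⟩ := exists_field x w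
  exact congrArg (fun f : SmoothFun m M => f x) ((S.toAlgebra hn hS).A_symm X Y)

/-- `Ric = μ g(h ·, ·)` on the distribution `η = 0` if `κ < 0`. -/
lemma ricci_leaf (hκ : κ < 0) (Y : SmoothField m M) (hY : ∀ x, S.η x (Y x) = 0) (x : M) :
    ricci nabla Y Y x = μ * S.g.inner x (S.Φ x (S.A nabla x (Y x))) (Y x) := by
  have hS := h.toIsAlmostCosymplectic
  have hY' : metricField S.g Y (SmoothVField.toField S.smooth_ξ) = 0 := by
    ext x; exact (S.g_ξ ..).trans (hY x)
  have hl : √(-κ) * √(-κ) = -κ := Real.mul_self_sqrt (by linarith)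
  have hi : 2 * √(-κ) * (2 * √(-κ))⁻¹ = 1 := mul_inv_cancel₀ (by
    have : 0 < √(-κ) := Real.sqrt_pos.2 (by linarith)
    positivity)
  have hl' := congrArg (algebraMap ℝ (SmoothFun m M)) hl
  have hi' := congrArg (algebraMap ℝ (SmoothFun m M)) hi
  simp only [map_mul, map_neg, map_one, map_ofNat] at hl' hi'
  have e := ricci_eq_trace hn.smooth Y Y x
    ((- S.g.inner x (S.A nabla x (Y x)) (Y x)) • S.A nabla x
      + (flat S.g (Y x) ∘ₗ S.A nabla x).smulRight (S.A nabla x (Y x))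
      + ((κ * S.g.inner x (Y x) (Y x) + μ * S.g.inner x (S.Φ x (S.A nabla x (Y x))) (Y x)) •
        flat S.g (S.ξ x)).smulRight (S.ξ x))
    fun X => by
      rw [← coe_R hn hS]
      have := congrArg (fun W : SmoothField m M => W x) ((h.toAlgebra hn).R_leaf hl' hi' X hY')
      refine this.trans ?_
      simp only [LinearMap.add_apply, LinearMap.smulRight_apply, LinearMap.smul_apply,
        LinearMap.comp_apply, flat_apply, smul_eq_mul]
      rw [S.g.symm x (Y x), S.g.symm x (S.ξ x), mul_comm _ (S.g.inner x (X x) (S.ξ x))]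
      rfl
  refine e.trans ?_
  simp only [map_add, map_smul, trace_tangent_smulRight, trace_A hn hS, LinearMap.comp_apply,
    LinearMap.smul_apply, flat_apply, S.g_ξ, S.η_ξ, smul_eq_mul]
  -- Since tr A = 0, what remains is |AY|² + κ|Y|² + μ g(φAY, Y), and |AY|² = −κ|Y|².
  rw [← inner_A hn h, inner_A_A hn h x _ (hY x)]
  ring

lemma ricci_add_ricci_φ (hκ : κ < 0) (Y : SmoothField m M) (hY : ∀ x, S.η x (Y x) = 0) (x : M) :
    ricci nabla Y Y x + ricci nabla (endoField S.smooth_φ Y) (endoField S.smooth_φ Y) x = 0 := by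
  have hS := h.toIsAlmostCosymplectic
  rw [ricci_leaf hn h hκ Y hY, ricci_leaf hn h hκ (endoField S.smooth_φ Y) fun x => S.η_φ ..]
  have h1 : S.A nabla x (S.φ x (Y x)) = - S.φ x (S.A nabla x (Y x)) :=
    congrArg (fun T => T (Y x)) (A_comp_Φ hn hS x)
  have h2 := S.compatible x (S.φ x (S.A nabla x (Y x))) (Y x)
  rw [S.η_φ] at h2
  simp only [endoField_apply, h1, Φ, ContinuousLinearMap.coe_coe, map_neg,
    neg_apply, h2]
  ring

end IsKappaMu

end AlmostContactMetric

end AlmostCosymplectic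

end

/-! ### Weyl connections: difference tensor, curvature and Ricci tensor. -/

noncomputable section

namespace AlmostCosymplectic

open CosymplecticAlgebra

/-! ### Weyl connections -/

namespace CosymplecticAlgebra

variable {C L : Type*} [CommRing C] [Algebra ℝ C] [AddCommGroup L] [Module C L]
  (G : CosymplecticAlgebra C L)

/-- The curvature of a connection. -/
def curv (D : L →ₗ[C] L →+ L) (X Y Z : L) : L := D X (D Y Z) - D Y (D X Z) - D (G.br X Y) Z

/-- A torsion-free connection with `D g = -2 θ ⊗ g` is determined by `θ`. -/
lemma weyl_inner {D : L →ₗ[C] L →+ L} {θ : L → C} (tor : ∀ X Y, D X Y - D Y X = G.br X Y)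
    (weyl : ∀ X Y Z, G.act Z (G.g X Y) - G.g (D Z X) Y - G.g X (D Z Y) = -2 * θ Z * G.g X Y)
    (X Y Z : L) :
    G.g (D X Y - G.D X Y) Z = θ X * G.g Y Z + θ Y * G.g X Z - G.g X Y * θ Z := by
  -- As in the uniqueness of the Levi-Civita connection, the defect is symmetric in X, Y by
  -- torsion-freeness and skew in Y, Z by metricity.
  refine sub_eq_zero.1 (eq_zero_of_symm_of_skew (p := fun X Y Z =>
    G.g (D X Y - G.D X Y) Z - (θ X * G.g Y Z + θ Y * G.g X Z - G.g X Y * θ Z)) ?_ ?_ X Y Z)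
  · intro X Y Z
    have : D X Y - G.D X Y = D Y X - G.D Y X := by
      have := tor X Y
      rw [br, sub_eq_sub_iff_add_eq_add] at this
      rw [sub_eq_sub_iff_add_eq_add, this, add_comm]
    rw [this, G.symm Y X]
    ring
  · intro X Y Z
    have h1 := weyl Y Z X
    have h2 := G.metric X Y Z
    simp only [map_sub, LinearMap.sub_apply]
    linear_combination -h1 + h2 - θ X * G.symm Z Y - G.symm Y (D X Z) + G.symm Y (G.D X Z)

/-- Existence of the field metrically dual to the Lee form. -/
lemma exists_lee_field {D : L →ₗ[C] L →+ L} {θ : L → C} (tor : ∀ X Y, D X Y - D Y X = G.br X Y)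
    (weyl : ∀ X Y Z, G.act Z (G.g X Y) - G.g (D Z X) Y - G.g X (D Z Y) = -2 * θ Z * G.g X Y) :
    ∃ V, ∀ X, G.g V X = θ X := by
  -- The difference tensor at (ξ, ξ) is 2θ(ξ)ξ minus the dual field. Solving for the dual field
  -- shows that it is smooth.
  refine ⟨(2 * θ G.ξ) • G.ξ - (D G.ξ G.ξ - G.D G.ξ G.ξ), fun X => ?_⟩
  rw [map_sub, LinearMap.sub_apply, G.weyl_inner tor weyl, map_smul, LinearMap.smul_apply, G.unit,
    smul_eq_mul]
  ring

lemma weyl_eq {D : L →ₗ[C] L →+ L} {V : L} (tor : ∀ X Y, D X Y - D Y X = G.br X Y)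
    (weyl : ∀ X Y Z, G.act Z (G.g X Y) - G.g (D Z X) Y - G.g X (D Z Y) = -2 * G.g V Z * G.g X Y)
    (X Y : L) : D X Y = G.D X Y + G.g V X • Y + G.g V Y • X - G.g X Y • V := by
  refine G.eq_of_g fun Z => ?_
  have := G.weyl_inner (θ := fun Z => G.g V Z) tor weyl X Y Z
  simp only [map_add, map_sub, map_smul, LinearMap.add_apply, LinearMap.sub_apply,
    LinearMap.smul_apply, smul_eq_mul] at this ⊢
  linear_combination this

/-- The part of the Weyl curvature that is linear in the Lee field. -/
def weylLin (V X Y Z : L) : L :=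
  G.g (G.D X V) Y • Z + G.g (G.D X V) Z • Y - G.g Y Z • G.D X V
    - (G.g (G.D Y V) X • Z + G.g (G.D Y V) Z • X - G.g X Z • G.D Y V)

/-- The part of the Weyl curvature that is quadratic in the Lee field. -/
def weylQuad (V X Y Z : L) : L :=
  (G.g V Y * G.g V Z - G.g Y Z * G.g V V) • X + (G.g X Z * G.g V V - G.g V X * G.g V Z) • Y
    + (G.g V X * G.g Y Z - G.g X Z * G.g V Y) • V

lemma curv_weyl {D : L →ₗ[C] L →+ L} {V : L}
    (hD : ∀ X Y, D X Y = G.D X Y + G.g V X • Y + G.g V Y • X - G.g X Y • V) (X Y Z : L) :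
    G.curv D X Y Z = G.R X Y Z + G.weylLin V X Y Z + G.weylQuad V X Y Z := by
  simp only [curv, R, br, weylLin, weylQuad, hD, map_add, map_sub, map_smul,
    AddMonoidHom.sub_apply, smul_eq_mul,
    G.leibniz, G.metric, smul_add, smul_sub, add_smul, sub_smul, G.symm _ V, G.symm X (G.D Y Z),
    G.symm Y (G.D X Z), G.symm Y X]
  module

end CosymplecticAlgebra

variable {m : ℕ} {M : Type*} [TopologicalSpace M]
  [ChartedSpace (EuclideanSpace ℝ (Fin m)) M] [IsManifold (𝓡 m) ∞ M]

/-- A smooth 1-form as a function on smooth fields. -/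
def SmoothOneForm.onField {θ : OneForm m M} (hθ : SmoothOneForm θ) (X : SmoothField m M) :
    SmoothFun m M := ⟨fun x => θ x (X x), hθ.smooth_apply X.smooth⟩

namespace AlmostContactMetric

variable {S : AlmostContactMetric m M} {nabla : Connection m M}

lemma neg_lee {θ : OneForm m M} {V : SmoothField m M}
    (hV : ∀ X : SmoothField m M, ∀ x, S.g.inner x (V x) (X x) = θ x (X x)) (X : SmoothField m M) (x : M) :
    S.g.inner x ((-V : SmoothField m M) x) (X x) = (-θ) x (X x) := by
  rw [ContMDiffSection.coe_neg, Pi.neg_apply, map_neg, neg_apply, hV]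
  rfl

variable (hn : IsLeviCivita S.g nabla) (hS : S.IsAlmostCosymplectic)

include hn hS

lemma weyl_tor {D : Connection m M} (hD : IsTorsionFree D)
    (X Y : SmoothField m M) :
    connField D hD.smooth X Y - connField D hD.smooth Y X = (S.toAlgebra hn hS).br X Y := by
  ext x : 1
  exact (congrFun (coe_bracket hD X Y) x).trans
    (congrFun (coe_bracket hn.toIsTorsionFree X Y) x).symm

lemma weyl_metric {D : Connection m M} {θ : OneForm m M} (hD : IsWeyl S.g θ D)
    (X Y Z : SmoothField m M) :
    (S.toAlgebra hn hS).act Z ((S.toAlgebra hn hS).g X Y)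
      - (S.toAlgebra hn hS).g (connField D hD.smooth Z X) Y
      - (S.toAlgebra hn hS).g X (connField D hD.smooth Z Y)
      = -2 * hD.smooth_lee.onField Z * (S.toAlgebra hn hS).g X Y := by
  have h2 (x : M) : (-2 : SmoothFun m M) x = -2 := by
    have : (-2 : SmoothFun m M) = algebraMap ℝ _ (-2) := by
      rw [map_neg, map_ofNat]
    rw [this]
    rfl
  ext x
  refine (hD.weyl X Y Z X.smooth Y.smooth Z.smooth x).trans ?_
  rw [ContMDiffMap.coe_mul, Pi.mul_apply, ContMDiffMap.coe_mul, Pi.mul_apply, h2]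
  rfl

/-- The field metrically dual to the Lee form. -/
lemma exists_lee_field {D : Connection m M} {θ : OneForm m M} (hD : IsWeyl S.g θ D) :
    ∃ V : SmoothField m M, ∀ X : SmoothField m M, ∀ x, S.g.inner x (V x) (X x) = θ x (X x) := by
  obtain ⟨V, hV⟩ := (S.toAlgebra hn hS).exists_lee_field (weyl_tor hn hS hD.toIsTorsionFree)
    (weyl_metric hn hS hD)
  exact ⟨V, fun X x => congrArg (fun f : SmoothFun m M => f x) (hV X)⟩

lemma curvature_weyl {D : Connection m M} {θ : OneForm m M} (hD : IsWeyl S.g θ D)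
    {V : SmoothField m M} (hV : ∀ X : SmoothField m M, ∀ x, S.g.inner x (V x) (X x) = θ x (X x))
    (X Y Z : SmoothField m M) (x : M) :
    curvature D X Y Z x = curvature nabla X Y Z x
      + (S.toAlgebra hn hS).weylLin V X Y Z x + (S.toAlgebra hn hS).weylQuad V X Y Z x := by
  have h := (S.toAlgebra hn hS).curv_weyl (V := V)
    ((S.toAlgebra hn hS).weyl_eq (weyl_tor hn hS hD.toIsTorsionFree) fun X Y Z => by
      rw [weyl_metric hn hS hD]
      congr 2
      ext x
      exact (hV Z x).symm) X Y Z
  rw [← coe_R hn hS]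
  refine Eq.trans ?_ (congrArg (fun W : SmoothField m M => W x) h)
  unfold curvature covDeriv
  rw [← coe_bracket hn.toIsTorsionFree]
  rfl

/-- With `weylQuad_neg`, this separates the two parts of the curvature: the sum over θ and −θ keeps
the quadratic part, the difference keeps the linear part. -/
lemma weylLin_neg (V X Y Z : SmoothField m M) (x : M) :
    (S.toAlgebra hn hS).weylLin (-V) X Y Z x = - (S.toAlgebra hn hS).weylLin V X Y Z x := by
  have : (S.toAlgebra hn hS).weylLin (-V) X Y Z = - (S.toAlgebra hn hS).weylLin V X Y Z := by
    simp only [weylLin, map_neg, LinearMap.neg_apply]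
    module
  rw [this]
  rfl

lemma weylQuad_neg (V X Y Z : SmoothField m M) (x : M) :
    (S.toAlgebra hn hS).weylQuad (-V) X Y Z x = (S.toAlgebra hn hS).weylQuad V X Y Z x := by
  have : (S.toAlgebra hn hS).weylQuad (-V) X Y Z = (S.toAlgebra hn hS).weylQuad V X Y Z := by
    simp only [weylQuad, map_neg, LinearMap.neg_apply]
    module
  rw [this]

variable [T2Space M] {θ : OneForm m M} {D₁ D₂ : Connection m M} (h₁ : IsWeyl S.g θ D₁)
  (h₂ : IsWeyl S.g (-θ) D₂) {V : SmoothField m M}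
  (hV : ∀ X : SmoothField m M, ∀ x, S.g.inner x (V x) (X x) = θ x (X x))
include h₁ h₂ hV

lemma ricci_weyl_add (Y Z : SmoothField m M) (x : M) :
    ricci D₁ Y Z x + ricci D₂ Y Z x = 2 * ricci nabla Y Z x
      + 2 * (m - 2) * (θ x (Y x) * θ x (Z x)
        - S.g.inner x (Y x) (Z x) * S.g.inner x (V x) (V x)) := by
  -- The weights 1, 1, −2 cancel the Levi-Civita curvature and the linear part, leaving an explicit
  -- endomorphism to trace.
  have e := sum_ricci_eq_trace (Finset.univ : Finset (Fin 3)) ![1, 1, -2] (D := ![D₁, D₂, nabla])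
    (fun j => by fin_cases j; exacts [h₁.smooth, h₂.smooth, hn.smooth]) (Y := fun _ => Y)
    (Z := fun _ => Z) (fun _ => Z.smooth) x
    ((2 : ℝ) • ((θ x (Y x) * θ x (Z x) - S.g.inner x (Y x) (Z x) * S.g.inner x (V x) (V x)) •
        LinearMap.id
      + (S.g.inner x (V x) (V x) • flat S.g (Z x) - θ x (Z x) • flat S.g (V x)).smulRight (Y x)
      + (S.g.inner x (Y x) (Z x) • flat S.g (V x) - θ x (Y x) • flat S.g (Z x)).smulRight (V x)))
    fun X => by
      simp only [Fin.sum_univ_three, Matrix.cons_val_zero, Matrix.cons_val_one, Matrix.cons_val]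
      have q : (S.toAlgebra hn hS).weylQuad V X Y Z x
          = (S.g.inner x (V x) (Y x) * S.g.inner x (V x) (Z x)
              - S.g.inner x (Y x) (Z x) * S.g.inner x (V x) (V x)) • X x
            + (S.g.inner x (X x) (Z x) * S.g.inner x (V x) (V x)
              - S.g.inner x (V x) (X x) * S.g.inner x (V x) (Z x)) • Y x
            + (S.g.inner x (V x) (X x) * S.g.inner x (Y x) (Z x)
              - S.g.inner x (X x) (Z x) * S.g.inner x (V x) (Y x)) • V x := rfl
      rw [curvature_weyl hn hS h₁ hV, curvature_weyl hn hS h₂ (neg_lee hV),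
        weylLin_neg, weylQuad_neg, q]
      simp only [← hV, LinearMap.add_apply, LinearMap.smulRight_apply, LinearMap.smul_apply,
        LinearMap.sub_apply, flat_apply, smul_eq_mul, LinearMap.id_apply, S.g.symm x (Z x) (X x)]
      module
  simp only [Fin.sum_univ_three, Matrix.cons_val_zero, Matrix.cons_val_one, Matrix.cons_val,
    map_add, map_smul, trace_tangent_smulRight, trace_tangent_id, LinearMap.sub_apply,
    LinearMap.smul_apply, flat_apply, smul_eq_mul, hV, S.g.symm x (Z x)] at e
  rw [hV V]
  linear_combination e

lemma ricci_weyl_sub (Y Z : SmoothField m M) (x : M) :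
    ricci D₁ Y Z x - ricci D₂ Y Z x = 2 * (S.g.inner x (nabla V x (Z x)) (Y x)
      + (1 - m) * S.g.inner x (nabla V x (Y x)) (Z x)
      - S.g.inner x (Y x) (Z x) * LinearMap.trace ℝ _ (nabla V x).toLinearMap) := by
  have e := sum_ricci_eq_trace (Finset.univ : Finset (Fin 2)) ![1, -1] (D := ![D₁, D₂])
    (fun j => by fin_cases j; exacts [h₁.smooth, h₂.smooth]) (Y := fun _ => Y)
    (Z := fun _ => Z) (fun _ => Z.smooth) x
    ((2 : ℝ) • ((flat S.g (Y x) ∘ₗ (nabla V x).toLinearMap).smulRight (Z x)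
      + (flat S.g (Z x) ∘ₗ (nabla V x).toLinearMap).smulRight (Y x)
      - S.g.inner x (Y x) (Z x) • (nabla V x).toLinearMap
      - ((flat S.g (nabla V x (Y x))).smulRight (Z x)
        + S.g.inner x (nabla V x (Y x)) (Z x) • LinearMap.id
        - (flat S.g (Z x)).smulRight (nabla V x (Y x)))))
    fun X => by
      simp only [Fin.sum_univ_two, Matrix.cons_val_zero, Matrix.cons_val_one]
      have q : (S.toAlgebra hn hS).weylLin V X Y Z x
          = S.g.inner x (nabla V x (X x)) (Y x) • Z x + S.g.inner x (nabla V x (X x)) (Z x) • Y x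
            - S.g.inner x (Y x) (Z x) • nabla V x (X x)
            - (S.g.inner x (nabla V x (Y x)) (X x) • Z x
              + S.g.inner x (nabla V x (Y x)) (Z x) • X x
              - S.g.inner x (X x) (Z x) • nabla V x (Y x)) := rfl
      rw [curvature_weyl hn hS h₁ hV, curvature_weyl hn hS h₂ (neg_lee hV),
        weylLin_neg, weylQuad_neg, q]
      simp only [LinearMap.add_apply, LinearMap.smulRight_apply, LinearMap.smul_apply,
        LinearMap.sub_apply, LinearMap.comp_apply, flat_apply, LinearMap.id_apply,
        ContinuousLinearMap.coe_coe, S.g.symm x (Z x), S.g.symm x (Y x) (nabla V x (X x))]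
      module
  simp only [Fin.sum_univ_two, Matrix.cons_val_zero, Matrix.cons_val_one,
    map_add, map_smul, map_sub, trace_tangent_smulRight, trace_tangent_id, LinearMap.comp_apply,
    ContinuousLinearMap.coe_coe, flat_apply, smul_eq_mul, S.g.symm x (Z x),
    S.g.symm x (Y x) (nabla V x (Z x))] at e
  linear_combination e

end AlmostContactMetric

end AlmostCosymplectic

end

/-! ### Low-dimensional cosymplectic cases and nonexistence for κ < 0. -/

noncomputable section

namespace AlmostCosymplectic

open CosymplecticAlgebra

namespace CosymplecticAlgebra

variable {C L : Type*} [CommRing C] [Algebra ℝ C] [AddCommGroup L] [Module C L]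
  (G : CosymplecticAlgebra C L)

lemma nijenhuis_eq_zero (h : ∀ X Y, G.dφ X Y = 0) (X Y : L) :
    G.φ (G.φ (G.br X Y)) + G.br (G.φ X) (G.φ Y) - G.φ (G.br (G.φ X) Y) - G.φ (G.br X (G.φ Y)) = 0 := by
  simp only [br, D_φ, h, zero_add, map_sub]
  abel

/-- If the Lee field is proportional to `ξ` along the leaves of `η = 0` and does not vanish, its
covariant derivative is that of `ξ`. -/
lemma lee_D_mul {V : L} (hV : ∀ Y, G.g Y G.ξ = 0 → G.g V Y * G.g V G.ξ = 0) {Y : L}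
    (hY : G.g Y G.ξ = 0) :
    G.g (G.D Y V) Y * G.g V G.ξ = G.g V G.ξ * G.g V G.ξ * G.g Y (G.A Y)
      - G.g V Y * G.act Y (G.g V G.ξ) := by
  have h1 := congrArg (G.act Y) (hV Y hY)
  rw [Derivation.leibniz, map_zero, smul_eq_mul, smul_eq_mul, G.metric Y V Y] at h1
  -- Applying the hypothesis to the horizontal part of ∇_Y Y trades g(V, ∇_Y Y) for its ξ-component,
  -- which is −g(Y, AY).
  have h2 := hV (G.D Y Y - G.g (G.D Y Y) G.ξ • G.ξ) (by simp [G.unit])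
  rw [G.η_D hY] at h2
  simp only [map_sub, map_smul, smul_eq_mul] at h2
  linear_combination h1 - h2

lemma A_eq_zero {μ : C} (h : G.IsKappaMu 0 μ) (X : L) : G.A X = 0 := by
  apply G.definite
  rw [h.g_A_A]
  simp

/-- If the leaves of `η = 0` are two-dimensional and `∇ξ = 0`, then `φ` is parallel. -/
lemma g_smul_dφ (hA : ∀ X, G.A X = 0)
    (hdim : ∀ Y Z, G.g Y G.ξ = 0 → G.g Z G.ξ = 0 →
      G.g Y Y • Z = G.g Z Y • Y + G.g Z (G.φ Y) • G.φ Y) (X : L) {Y : L} (hY : G.g Y G.ξ = 0) :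
    G.g Y Y • G.dφ X Y = 0 := by
  have h1 : G.g (G.dφ X Y) Y = 0 := eq_zero_of_two_mul (by
    linear_combination G.dφ_skew X Y Y - G.symm Y (G.dφ X Y))
  have h2 : G.g (G.dφ X Y) (G.φ Y) = 0 := eq_zero_of_two_mul (by
    linear_combination - G.dφ_φ_leaf (X := X) hY hY + G.dφ_skew X (G.φ Y) Y
      - G.symm (G.φ Y) (G.dφ X Y))
  rw [G.eq_smul_ξ (U := G.g Y Y • G.dφ X Y)]
  · rw [map_smul, LinearMap.smul_apply, dφ_skew, dφ_ξ_right, hA]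
    simp
  · intro Z hZ
    have := congrArg (fun W => G.g (G.dφ X Y) W) (hdim Y Z hY hZ)
    simp only [map_add, map_smul, smul_eq_mul, h1, h2] at this
    rw [map_smul, LinearMap.smul_apply, smul_eq_mul, this]
    ring

end CosymplecticAlgebra

variable {m : ℕ} {M : Type*} [TopologicalSpace M]
  [ChartedSpace (EuclideanSpace ℝ (Fin m)) M] [IsManifold (𝓡 m) ∞ M]

omit [IsManifold (𝓡 m) ∞ M] in
lemma finrank_tangent (x : M) : Module.finrank ℝ (TangentSpace (𝓡 m) x) = m := by
  rw [Module.finrank_eq_card_basis (tangentBasis m x), Fintype.card_fin]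

namespace AlmostContactMetric

variable {S : AlmostContactMetric m M} {nabla : Connection m M}

/-! ### Pointwise algebra -/

lemma exists_horizontal (hm : 2 ≤ m) (x : M) :
    ∃ v : TangentSpace (𝓡 m) x, v ≠ 0 ∧ S.η x v = 0 := by
  have := Module.Finite.of_basis (tangentBasis m x)
  have h := LinearMap.ker_ne_bot_of_finrank_lt (f := (S.η x).toLinearMap)
    (by rw [finrank_tangent, Module.finrank_self]; omega)
  obtain ⟨v, hv, h0⟩ := (Submodule.ne_bot_iff _).1 h
  exact ⟨v, h0, hv⟩

lemma inner_φ_self {x : M} (v : TangentSpace (𝓡 m) x) : S.g.inner x v (S.φ x v) = 0 := by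
  have h := S.compatible x v (S.φ x v)
  rw [S.φ_sq, S.η_φ, map_add, map_neg, map_smul, S.g_ξ, S.η_φ, S.g.symm] at h
  simp only [smul_zero, mul_zero, add_zero, sub_zero] at h
  linarith

lemma inner_φ_φ {x : M} {v : TangentSpace (𝓡 m) x} (hv : S.η x v = 0) :
    S.g.inner x (S.φ x v) (S.φ x v) = S.g.inner x v v := by
  rw [S.compatible, hv]; ring

lemma inner_ξ {x : M} (v : TangentSpace (𝓡 m) x) : S.g.inner x (S.ξ x) v = S.η x v := by
  rw [S.g.symm, S.g_ξ]

/-- In dimension three, `v, φ v` span the orthogonal complement of `ξ`. -/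
lemma inner_smul_eq (hm : m = 3) {x : M} {v w : TangentSpace (𝓡 m) x} (hv : S.η x v = 0)
    (hw : S.η x w = 0) :
    S.g.inner x v v • w = S.g.inner x w v • v + S.g.inner x w (S.φ x v) • S.φ x v := by
  by_cases h0 : v = 0
  · simp [h0]
  have hp := (S.g.pos x v h0).ne'
  have := Module.Finite.of_basis (tangentBasis m x)
  have hli : LinearIndependent ℝ ![S.ξ x, v, S.φ x v] := by
    rw [Fintype.linearIndependent_iff]
    intro c hc
    simp only [Fin.sum_univ_three, Matrix.cons_val_zero, Matrix.cons_val_one,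
      Matrix.cons_val] at hc
    have e1 := congrArg (S.g.inner x (S.ξ x)) hc
    have e2 := congrArg (S.g.inner x v) hc
    have e3 := congrArg (S.g.inner x (S.φ x v)) hc
    simp only [map_add, map_smul, inner_ξ, S.η_ξ, hv, S.η_φ, S.g_ξ, inner_φ_self, inner_φ_φ hv,
      S.g.symm x (S.φ x v) v, smul_eq_mul, mul_zero, mul_one, add_zero, zero_add, map_zero,
      mul_eq_zero, hp, or_false] at e1 e2 e3
    intro i
    fin_cases i <;> assumption
  let b := basisOfLinearIndependentOfCardEqFinrank hli (by
    rw [finrank_tangent, hm, Fintype.card_fin])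
  rw [← sub_eq_zero]
  set u := S.g.inner x v v • w - (S.g.inner x w v • v + S.g.inner x w (S.φ x v) • S.φ x v) with hu
  have hz : flat S.g u = 0 := by
    refine b.ext fun i => ?_
    rw [coe_basisOfLinearIndependentOfCardEqFinrank, flat_apply, S.g.symm]
    fin_cases i
    · simp [hu, inner_ξ, hv, hw, S.η_φ]
    · simp [hu, inner_φ_self, S.g.symm x v w]
      ring
    · simp [hu, inner_φ_self, inner_φ_φ hv, S.g.symm x (S.φ x v)]
      ring
  exact metric_eq_zero S.g (congrArg (fun T => T u) hz)

lemma φ_eq_zero (hm : m = 1) {x : M} (v : TangentSpace (𝓡 m) x) : S.φ x v = 0 := by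
  have hξ : S.ξ x ≠ 0 := fun h => by
    have := S.η_ξ x
    rw [h, map_zero] at this
    exact zero_ne_one this
  obtain ⟨c, rfl⟩ := (finrank_eq_one_iff_of_nonzero' _ hξ).1 ((finrank_tangent x).trans hm) v
  rw [map_smul, S.φ_ξ, smul_zero]

/-! ### Normality -/

lemma isCosymplectic_of_parallel (hn : IsLeviCivita S.g nabla) (hS : S.IsAlmostCosymplectic)
    (h : ∀ X Y, (S.toAlgebra hn hS).dφ X Y = 0) : S.IsCosymplectic where
  toIsAlmostCosymplectic := hS
  normal X Y hX hY x := by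
    have e := congrArg (fun W : SmoothField m M => W x)
      ((S.toAlgebra hn hS).nijenhuis_eq_zero h hX.toField hY.toField)
    have br (X Y : SmoothField m M) : ⇑((S.toAlgebra hn hS).br X Y) = bracket X Y :=
      coe_bracket hn.toIsTorsionFree X Y
    rw [hS.closed_η X Y hX hY, zero_smul, add_zero]
    refine Eq.trans ?_ e
    simp only [ContMDiffSection.coe_sub, ContMDiffSection.coe_add, Pi.sub_apply, Pi.add_apply,
      toAlgebra_φ, endoField_apply, br]
    rfl

lemma isCosymplectic_of_dim_one (hm : m = 1) (hn : IsLeviCivita S.g nabla)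
    (hS : S.IsAlmostCosymplectic) : S.IsCosymplectic := by
  refine isCosymplectic_of_parallel hn hS fun X Y => ?_
  have : endoField S.smooth_φ = 0 := by
    ext X x : 2
    exact φ_eq_zero hm _
  simp [dφ, this]

/-- A vector orthogonal to `ξ` extends to a smooth field orthogonal to `ξ`. -/
lemma exists_horizontal_field [T2Space M] {x : M} {v : TangentSpace (𝓡 m) x}
    (hv : S.η x v = 0) :
    ∃ X : SmoothField m M, (∀ y, S.η y (X y) = 0) ∧ X x = v := by
  obtain ⟨X, rfl⟩ := exists_field x v
  refine ⟨X - metricField S.g X (SmoothVField.toField S.smooth_ξ) •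
    SmoothVField.toField S.smooth_ξ, fun y => ?_, ?_⟩
  · simp [S.g_ξ, S.η_ξ]
  · simp [S.g_ξ, hv]

lemma metricField_ξ_eq_zero {X : SmoothField m M} (hX : ∀ y, S.η y (X y) = 0) :
    metricField S.g X (SmoothVField.toField S.smooth_ξ) = 0 := by
  ext x
  exact (S.g_ξ ..).trans (hX x)

lemma η_eq_zero {X : SmoothField m M}
    (hX : metricField S.g X (SmoothVField.toField S.smooth_ξ) = 0) (y : M) : S.η y (X y) = 0 := by
  rw [← S.g_ξ]
  exact congrArg (fun f : SmoothFun m M => f y) hX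

lemma isCosymplectic_of_dim_three [T2Space M] (hm : m = 3) (hn : IsLeviCivita S.g nabla) {μ : ℝ}
    (h : S.IsKappaMu nabla 0 μ) : S.IsCosymplectic := by
  have hS := h.toIsAlmostCosymplectic
  have hk := h.toAlgebra hn
  rw [map_zero] at hk
  have hA := (S.toAlgebra hn hS).A_eq_zero hk
  have key (X : SmoothField m M) {Y : SmoothField m M}
      (hY : metricField S.g Y (SmoothVField.toField S.smooth_ξ) = 0) (x : M) (hx : Y x ≠ 0) :
      (S.toAlgebra hn hS).dφ X Y x = 0 := by
    have := congrArg (fun W : SmoothField m M => W x) ((S.toAlgebra hn hS).g_smul_dφ hA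
      (fun Y Z hY hZ => by
        ext x : 1
        exact inner_smul_eq hm (η_eq_zero hY x) (η_eq_zero hZ x)) X hY)
    exact (smul_eq_zero.1 this).resolve_left (S.g.pos x _ hx).ne'
  have key2 (X : SmoothField m M) {Y : SmoothField m M}
      (hY : metricField S.g Y (SmoothVField.toField S.smooth_ξ) = 0) :
      (S.toAlgebra hn hS).dφ X Y = 0 := by
    ext x : 1
    by_cases hx : Y x = 0
    -- The identity |Y|²(∇_X φ)Y = 0 says nothing at a zero of Y. There Y is the difference of two
    -- horizontal fields that do not vanish at x, so additivity suffices.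
    · obtain ⟨v, hv, hv0⟩ := exists_horizontal (S := S) (by omega) x
      obtain ⟨Y', hY', rfl⟩ := exists_horizontal_field hv0
      have h1 := key X (metricField_ξ_eq_zero hY') x hv
      have h2 := key X (Y := Y + Y') (by
        rw [map_add, LinearMap.add_apply, hY, metricField_ξ_eq_zero hY', add_zero]) x (by
        rw [ContMDiffSection.coe_add, Pi.add_apply, hx, zero_add]
        exact hv)
      rw [dφ_add, ContMDiffSection.coe_add, Pi.add_apply, h1, add_zero] at h2
      exact h2
    · exact key X hY x hx
  refine isCosymplectic_of_parallel hn hS fun X Y => ?_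
  set G := S.toAlgebra hn hS with hG
  have d : Y = (Y - G.g Y G.ξ • G.ξ) + G.g Y G.ξ • G.ξ := by abel
  rw [d, dφ_add, dφ_smul, dφ_ξ_right, hA, map_zero, neg_zero, smul_zero, add_zero]
  refine key2 X (?_ : G.g _ G.ξ = 0)
  simp [G.unit]

/-! ### Nonexistence for `κ ≠ 0` -/

section
variable [T2Space M] {κ μ : ℝ} (hn : IsLeviCivita S.g nabla) (h : S.IsKappaMu nabla κ μ)
include hn h

/-- For a nonzero horizontal v, 0 ≤ |Av|² = −κ|v|². -/
lemma IsKappaMu.κ_nonpos (hm : 2 ≤ m) (x : M) : κ ≤ 0 := by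
  obtain ⟨v, hv, hv0⟩ := exists_horizontal (S := S) hm x
  have h1 := h.inner_A_A hn x v hv0
  have h2 := S.g.pos x v hv
  have h3 : 0 ≤ S.g.inner x (S.A nabla x v) (S.A nabla x v) := by
    by_cases h0 : S.A nabla x v = 0
    · simp [h0]
    · exact (S.g.pos x _ h0).le
  nlinarith

variable {θ : OneForm m M} {D₁ D₂ : Connection m M} (h₁ : IsEinsteinWeyl S.g θ D₁)
  (h₂ : IsEinsteinWeyl S.g (-θ) D₂)
include h₁ h₂

omit h in
-- The sum of the two Einstein–Weyl equations; the term |V|² g is absorbed into the factor F.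
lemma exists_ricci_eq (hS : S.IsAlmostCosymplectic) (x : M) :
    ∃ F : ℝ, ∀ Y Z : SmoothField m M,
      ricci nabla Y Z x + ricci nabla Z Y x + 2 * (m - 2) * (θ x (Y x) * θ x (Z x))
        = F * S.g.inner x (Y x) (Z x) := by
  obtain ⟨V, hV⟩ := exists_lee_field hn hS h₁.toIsWeyl
  obtain ⟨Λ₁, -, e₁⟩ := h₁.einstein_weyl
  obtain ⟨Λ₂, -, e₂⟩ := h₂.einstein_weyl
  refine ⟨(Λ₁ x + Λ₂ x) / 2 + 2 * (m - 2) * S.g.inner x (V x) (V x), fun Y Z => ?_⟩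
  have a₁ := ricci_weyl_add hn hS h₁.toIsWeyl h₂.toIsWeyl hV Y Z x
  have a₂ := ricci_weyl_add hn hS h₁.toIsWeyl h₂.toIsWeyl hV Z Y x
  have b₁ := e₁ Z Y Z.smooth Y.smooth x
  have b₂ := e₂ Z Y Z.smooth Y.smooth x
  rw [S.g.symm x (Z x)] at a₂
  linear_combination - (a₁ + a₂) / 2 + (b₁ + b₂) / 2

omit h in
-- The difference of the two Einstein–Weyl equations on the diagonal, where ∇V appears with the
-- factor 2 − m.
lemma exists_conformal_killing (hm : m ≠ 2) (hS : S.IsAlmostCosymplectic) {V : SmoothField m M}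
    (hV : ∀ X : SmoothField m M, ∀ x, S.g.inner x (V x) (X x) = θ x (X x)) (x : M) :
    ∃ c : ℝ, ∀ Y : SmoothField m M,
      S.g.inner x (nabla V x (Y x)) (Y x) = c * S.g.inner x (Y x) (Y x) := by
  obtain ⟨Λ₁, -, e₁⟩ := h₁.einstein_weyl
  obtain ⟨Λ₂, -, e₂⟩ := h₂.einstein_weyl
  have hm' : (m : ℝ) - 2 ≠ 0 := fun h => hm (by
    have : (m : ℝ) = (2 : ℕ) := by push_cast; linarith
    exact_mod_cast this)
  refine ⟨-((Λ₁ x - Λ₂ x) / 4 + LinearMap.trace ℝ _ (nabla V x).toLinearMap) / (m - 2),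
    fun Y => ?_⟩
  have a := ricci_weyl_sub hn hS h₁.toIsWeyl h₂.toIsWeyl hV Y Y x
  have b₁ := e₁ Y Y Y.smooth Y.smooth x
  have b₂ := e₂ Y Y Y.smooth Y.smooth x
  rw [div_mul_eq_mul_div, eq_div_iff hm']
  linear_combination a / 2 - b₁ / 4 + b₂ / 4

/-- For `κ < 0` there are no two Einstein–Weyl structures with opposite Lee forms. -/
theorem IsKappaMu.not_einsteinWeyl_pair (hm : 3 ≤ m) (hκ : κ < 0) (x : M) : False := by
  have hS := h.toIsAlmostCosymplectic
  have hm1 : (0 : ℝ) < m - 2 := by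
    have : (3 : ℝ) ≤ m := by exact_mod_cast hm
    linarith
  obtain ⟨V, hV⟩ := exists_lee_field hn hS h₁.toIsWeyl
  obtain ⟨v, hv, hv0⟩ := exists_horizontal (S := S) (by omega) x
  have hpos := S.g.pos x v hv
  let ξ : SmoothField m M := SmoothVField.toField S.smooth_ξ
  have hprod (Y : SmoothField m M) (hY : ∀ y, S.η y (Y y) = 0) (y : M) :
      θ y (Y y) * θ y (S.ξ y) = 0 := by
    obtain ⟨F, hF⟩ := exists_ricci_eq hn h₁ h₂ hS y
    have e := hF Y ξ
    have e1 : ricci nabla Y ξ y = 0 := (h.ricci_ξ hn Y y).trans (by rw [hY]; ring)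
    have e2 : ricci nabla ξ Y y = 0 := h.ricci_ξ_left hn Y hY y
    have e3 : S.g.inner y (Y y) (ξ y) = 0 := (S.g_ξ ..).trans (hY y)
    rw [e1, e2, e3] at e
    have e4 : 2 * ((m : ℝ) - 2) * (θ y (Y y) * θ y (S.ξ y)) = 0 := by
      change 0 + 0 + 2 * ((m : ℝ) - 2) * (θ y (Y y) * θ y (S.ξ y)) = _ at e
      linarith
    exact (mul_eq_zero.1 e4).resolve_left (by positivity)
  by_cases hξ : θ x (S.ξ x) = 0
  · obtain ⟨F, hF⟩ := exists_ricci_eq hn h₁ h₂ hS x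
    have e := hF ξ ξ
    have e1 : ricci nabla ξ ξ x = (m - 1) * κ := (h.ricci_ξ hn ξ x).trans (by
      change _ * S.η x (S.ξ x) = _
      rw [S.η_ξ, mul_one])
    have e2 : θ x (ξ x) = 0 := hξ
    have e3 : S.g.inner x (ξ x) (ξ x) = 1 := (S.g_ξ ..).trans (S.η_ξ x)
    rw [e1, e2, e3] at e
    obtain ⟨Y, hY, rfl⟩ := exists_horizontal_field hv0
    have a := hF Y Y
    have b := hF (endoField S.smooth_φ Y) (endoField S.smooth_φ Y)
    have c := h.ricci_add_ricci_φ hn hκ Y hY x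
    rw [endoField_apply, inner_φ_φ hv0] at b
    -- With θ(ξ) = 0 the relation at (ξ, ξ) reads 2(m − 1)κ = F. Adding the relations for Y and φY
    -- then makes a sum of squares equal to 2F|Y|² < 0.
    have hF0 : F < 0 := by nlinarith
    have : 0 ≤ 2 * ((m : ℝ) - 2) * (θ x (Y x) * θ x (Y x) +
      θ x (S.φ x (Y x)) * θ x (S.φ x (Y x))) :=
      mul_nonneg (by linarith) (add_nonneg (mul_self_nonneg _) (mul_self_nonneg _))
    nlinarith
  · obtain ⟨c, hc⟩ := exists_conformal_killing hn h₁ h₂ (by omega) hS hV x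
    have key (w : TangentSpace (𝓡 m) x) (hw : S.η x w = 0) :
        c * S.g.inner x w w = θ x (S.ξ x) * S.g.inner x w (S.A nabla x w) := by
      obtain ⟨Y, hY, rfl⟩ := exists_horizontal_field hw
      rw [← hc]
      -- The relation θ(Y)θ(ξ) = 0 holds on all of M, so it may be differentiated. At x the
      -- derivative of θ(ξ) drops out because θ(Y) = 0 there.
      have e := congrArg (fun f : SmoothFun m M => f x) ((S.toAlgebra hn hS).lee_D_mul (V := V)
        (fun Y hY => by
          ext y
          have := hprod Y (η_eq_zero hY) y
          have hVξ : S.g.inner y (V y) (S.ξ y) = θ y (S.ξ y) := hV ξ y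
          rw [← hV Y, ← hVξ] at this
          exact this) (metricField_ξ_eq_zero hY))
      have e' : S.g.inner x (nabla V x (Y x)) (Y x) * S.g.inner x (V x) (ξ x)
          = S.g.inner x (V x) (ξ x) * S.g.inner x (V x) (ξ x) * S.g.inner x (Y x) (S.A nabla x (Y x))
            - S.g.inner x (V x) (Y x) * actField m M Y (metricField S.g V ξ) x := e
      have e0 : θ x (Y x) = 0 := (mul_eq_zero.1 (hprod Y hY x)).resolve_right hξ
      rw [hV, hV, e0] at e'
      refine mul_right_cancel₀ hξ ?_
      change _ * θ x (ξ x) = θ x (ξ x) * _ * θ x (ξ x)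
      linear_combination e'
    have hφ : S.A nabla x (S.φ x v) = - S.φ x (S.A nabla x v) :=
      congrArg (fun T => T v) (A_comp_Φ hn hS x)
    -- Replacing v by φv keeps the norm and flips the sign of g(v, Av), since A anticommutes with φ.
    have hc0 : c = 0 := by
      have k1 := key v hv0
      have k2 := key (S.φ x v) (S.η_φ ..)
      rw [inner_φ_φ hv0, hφ, map_neg, S.compatible, hv0] at k2
      have : c * S.g.inner x v v = 0 := by linarith
      exact (mul_eq_zero.1 this).resolve_right hpos.ne'
    have hz (w : TangentSpace (𝓡 m) x) (hw : S.η x w = 0) :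
        S.g.inner x w (S.A nabla x w) = 0 := by
      have := key w hw
      rw [hc0, zero_mul] at this
      exact (mul_eq_zero.1 this.symm).resolve_left hξ
    have hAv : S.η x (S.A nabla x v) = 0 := η_A_apply hn hS v
    have z1 := hz v hv0
    have z2 := hz _ hAv
    -- Polarizing at v and Av gives 2|Av|² = 0, against |Av|² = −κ|v|² > 0.
    have z3 := hz (v + S.A nabla x v) (by rw [map_add, hv0, hAv, add_zero])
    have z4 := h.inner_A_A hn x v hv0
    have z5 := h.inner_A hn x v (S.A nabla x v)
    simp only [map_add, add_apply, z1, z2] at z3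
    nlinarith

end

end AlmostContactMetric

end AlmostCosymplectic

end

/-! ### The theorem: case distinction on n and κ. -/

open AlmostCosymplectic in
theorem theorem4p2 (n : ℕ) {M : Type*} [TopologicalSpace M] [T2Space M]
    [SecondCountableTopology M]
    [ChartedSpace (EuclideanSpace ℝ (Fin (2 * n + 1))) M]
    [IsManifold (𝓡 (2 * n + 1)) ∞ M]
    (S : AlmostContactMetric (2 * n + 1) M)
    (nabla : Connection (2 * n + 1) M) (hnabla : IsLeviCivita S.g nabla)
    (κ μ : ℝ) (hS : S.IsKappaMu nabla κ μ)
    (hκ : 2 ≤ n → κ ≠ 0)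
    (θ : OneForm (2 * n + 1) M) (D₁ D₂ : Connection (2 * n + 1) M)
    (h₁ : IsEinsteinWeyl S.g θ D₁) (h₂ : IsEinsteinWeyl S.g (-θ) D₂) :
    S.IsCosymplectic ∨ IsEinstein S.g nabla := by
  rcases Nat.eq_zero_or_pos n with rfl | hn
  · exact .inl (AlmostContactMetric.isCosymplectic_of_dim_one rfl hnabla hS.toIsAlmostCosymplectic)
  by_cases h0 : κ = 0
  · obtain rfl : n = 1 := by
      by_contra h
      exact hκ (by omega) h0
    subst h0
    exact .inl (AlmostContactMetric.isCosymplectic_of_dim_three rfl hnabla hS)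
  -- The Einstein constant 0 is arbitrary: any point x yields a contradiction, so M is empty here.
  · refine .inr ⟨0, fun Y Z hY hZ x => (?_ : False).elim⟩
    exact hS.not_einsteinWeyl_pair hnabla h₁ h₂ (by omega)
      (lt_of_le_of_ne (hS.κ_nonpos hnabla (by omega) x) h0) x
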